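/- Let $\Omega$ be either $\mathbb{N}=\{1,2,\dots\}$ with counting measure $\mu$, or $[0,\infty)$ with Lebesgue measure $\mu$. Let $\{Z(t)\}_{t\in\Omega}$ be a real-valued centered stationary Gaussian process with unit variance $\mathbb{E}\,Z(t)^2=1$ and correlation function $A(h)=\mathbb{E}\,[Z(s)Z(s+h)]$ ($s,h\in\Omega$), whose sample paths are almost surely continuous (an empty condition if $\Omega=\mathbb{N}$). Assume that $A(h)\ge 0$ for all $h\in\Omega$. Then for every $r\in\mathbb{R}$ the limit $$\theta(A,r):=-\lim_{T\to\infty}\frac1T\log\mathbb{P}\Big(\sup_{t\in[0,T]\cap\Omega}Z(t)<r\Big)$$ exists in $[0,\infty]$ and depends only on $A$ and $r$, that is, it is the same for every process with these properties and with correlation function $A$. Moreover: (a) if $\int_\Omega A(t)\,\mu(dt)<\infty$, then $\theta(A,r)\in(0,\infty)$ for every $r\in\mathbb{R}$; (b) if $\int_\Omega A(t)\,\mu(dt)=\infty$, then $\theta(A,r)=0$ for every $r\in\mathbb{R}$. -/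

import Mathlib

open MeasureTheory ProbabilityTheory Filter Topology
open scoped NNReal ENNReal

universe u

/-- `Z` is a centered stationary Gaussian process of unit variance on the probability space
`(Ω, P)`, indexed by the time set `T` (which will be `ℕ+ = {1, 2, …}` or `ℝ≥0 = [0, ∞)`), with
correlation function `A`, and almost all of its sample paths are continuous.

A centered Gaussian process is stationary exactly when its covariances depend on the time lag
only; by symmetry it is enough to prescribe the covariance of `Z s` and `Z (s + h)`. -/
structure IsStationaryGaussian {T Ω : Type*} [TopologicalSpace T] [Add T] [MeasurableSpace Ω]
    (P : Measure Ω) (Z : T → Ω → ℝ) (A : T → ℝ) : Prop where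
  isGaussianProcess : IsGaussianProcess Z P
  centered : ∀ t, ∫ ω, Z t ω ∂P = 0
  unit_variance : ∀ t, ∫ ω, Z t ω ^ 2 ∂P = 1
  correlation : ∀ s h, ∫ ω, Z s ω * Z (s + h) ω ∂P = A h
  continuous_paths : ∀ᵐ ω ∂P, Continuous fun t => Z t ω

/-- The persistence probability `P (sup_{t ≤ x} Z t < r)`. The function `time` reads an element
of the time set as a nonnegative real number. The supremum is taken in the extended reals. -/
noncomputable def persistenceProb {T Ω : Type*} [MeasurableSpace Ω] (time : T → ℝ)
    (P : Measure Ω) (Z : T → Ω → ℝ) (r x : ℝ) : ℝ≥0∞ :=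
  P {ω | (⨆ t ∈ {t : T | time t ≤ x}, (Z t ω : EReal)) < (r : EReal)}

/-- `HasPersistenceExponent time A r θ` says that `θ(A, r) = θ`: for every centered stationary
Gaussian process `Z` with correlation function `A` and continuous paths, the limit of
`-(1 / x) * log P (sup_{t ≤ x} Z t < r)` as `x → ∞` exists in `[-∞, ∞]` and equals `θ`.
Here `ENNReal.log` is the extended logarithm, with `log 0 = -∞`. -/
def HasPersistenceExponent {T : Type} [TopologicalSpace T] [Add T] (time : T → ℝ)
    (A : T → ℝ) (r : ℝ) (θ : EReal) : Prop :=
  ∀ (Ω : Type u) [MeasurableSpace Ω] (P : Measure Ω) (Z : T → Ω → ℝ),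
    IsStationaryGaussian P Z A →
      Tendsto (fun x : ℝ => -(((1 / x : ℝ) : EReal) * ENNReal.log (persistenceProb time P Z r x)))
        atTop (𝓝 θ)

/-! Write `p(x)` for the probability that `Z` stays below `r` up to time `x`. Since correlations are
nonnegative, the events of staying below a level on two time sets are positively correlated
(`measure_forall_lt_mul_le`). With stationarity this makes `p` supermultiplicative, and Fekete's
lemma (`exists_tendsto_neg_log_div`) yields the limit, which is finite because `p(1) > 0`. Path
continuity reduces `p` to countably many times, and centered Gaussian laws are determined by
covariances, so only `A` and `r` matter (`persistenceProb_congr`).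

If `A` is integrable, then along a suitable arithmetic progression of times the off-diagonal
correlations in each row sum to at most 1/4. The sampled vector is then a Gaussian vector with
diagonally dominant covariance plus an independent white noise of variance 3/4. The noise makes the
probability of staying below `r` exponentially small in the number of samples
(`exists_forall_orthant_le_exp`), so the exponent is positive.

If `A` is not integrable, use Cameron–Martin shifts. Staying below `r + K` with `K` large is cheap.
Returning to level `r` costs the exponential of the variance of a linear functional of `Z` whose
covariance with every `Z t` in the window is at least `K`
(`ofReal_exp_neg_mul_persistenceProb_sq_le`). Take the total of `Z` over a window of length `2m`,
divided by `S(m)`, the integral of `A` up to `m`: its covariances are at least of order 1 and its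
variance is of order `m S(2m) / S(m)^2`. As `S` is unbounded but `S(m) ≤ m`, the ratio `S(2m) /
S(m)^2` is arbitrarily small for suitable `m` (`exists_two_mul_le_mul_sq`). By subadditivity one
good window already bounds the exponent. -/

/-! ### Centered Gaussian laws are determined by covariances -/

lemma hasGaussianLaw_comp_index {T Ω ι : Type*} [Finite ι] [MeasurableSpace Ω] {P : Measure Ω}
    {Z : T → Ω → ℝ} (hZ : IsGaussianProcess Z P) (f : ι → T) :
    HasGaussianLaw (fun ω i => Z (f i) ω) P := by
  have := Fintype.ofFinite ι
  have h := (hZ.comp_right f).hasGaussianLaw Finset.univ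
  exact h.map_fun (ContinuousLinearMap.pi fun i : ι =>
    ContinuousLinearMap.proj (R := ℝ) (φ := fun _ : (Finset.univ : Finset ι) => ℝ)
      ⟨i, Finset.mem_univ i⟩)

lemma strongDual_pi_apply {ι : Type*} [Fintype ι] [DecidableEq ι] (L : StrongDual ℝ (ι → ℝ))
    (x : ι → ℝ) : L x = ∑ i, x i * L (Pi.single i 1) := by
  conv_lhs => rw [pi_eq_sum_univ' x]
  simp [map_sum]

section Law

variable {ι Ω Ω' : Type*} [MeasurableSpace Ω] [MeasurableSpace Ω']
  {P : Measure Ω} {P' : Measure Ω'} {X : ι → Ω → ℝ} {Y : ι → Ω' → ℝ}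

lemma integrable_mul_of_hasGaussianLaw [Fintype ι] (hX : HasGaussianLaw (fun ω i => X i ω) P)
    (i j : ι) : Integrable (fun ω => X i ω * X j ω) P :=
  (hX.eval i).memLp_two.integrable_mul (hX.eval j).memLp_two

/-- A linear combination of the coordinates of a centered Gaussian vector is a real Gaussian
variable. -/
lemma map_sum_mul_eq_gaussianReal [Fintype ι] (hX : HasGaussianLaw (fun ω i => X i ω) P)
    (h0 : ∀ i, ∫ ω, X i ω ∂P = 0) (c : ι → ℝ) :
    P.map (fun ω => ∑ i, c i * X i ω) =
      gaussianReal 0 (∑ i, ∑ j, c i * c j * ∫ ω, X i ω * X j ω ∂P).toNNReal := by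
  classical
  have hprob := hX.isProbabilityMeasure
  have hL := hX.map_fun (∑ i, c i • ContinuousLinearMap.proj (R := ℝ) (φ := fun _ : ι => ℝ) i)
  simp only [sum_apply, smul_apply,
    ContinuousLinearMap.proj_apply, smul_eq_mul] at hL
  have hint : ∀ i, Integrable (X i) P := fun i => (hX.eval i).integrable
  have hm : ∫ ω, ∑ i, c i * X i ω ∂P = 0 := by
    rw [integral_finsetSum _ fun i _ => (hint i).const_mul _]
    simp [integral_const_mul, h0]
  rw [hL.map_eq_gaussianReal, hm, variance_of_integral_eq_zero hL.aemeasurable hm]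
  congr 2
  have : ∀ ω, (∑ i, c i * X i ω) ^ 2 = ∑ i, ∑ j, c i * c j * (X i ω * X j ω) := by
    intro ω
    rw [sq, Finset.sum_mul_sum]
    refine Finset.sum_congr rfl fun i _ => Finset.sum_congr rfl fun j _ => by ring
  have hij := integrable_mul_of_hasGaussianLaw hX
  simp_rw [this]
  rw [integral_finsetSum _ fun i _ => integrable_finsetSum _ fun j _ => (hij i j).const_mul _]
  refine Finset.sum_congr rfl fun i _ => ?_
  rw [integral_finsetSum _ fun j _ => (hij i j).const_mul _]
  simp_rw [integral_const_mul]

/-- Centered Gaussian vectors with the same covariances have the same law. -/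
lemma map_eq_of_integral_mul_eq [Fintype ι] (hX : HasGaussianLaw (fun ω i => X i ω) P)
    (hY : HasGaussianLaw (fun ω i => Y i ω) P')
    (hX0 : ∀ i, ∫ ω, X i ω ∂P = 0) (hY0 : ∀ i, ∫ ω, Y i ω ∂P' = 0)
    (hcov : ∀ i j, ∫ ω, X i ω * X j ω ∂P = ∫ ω, Y i ω * Y j ω ∂P') :
    P.map (fun ω i => X i ω) = P'.map (fun ω i => Y i ω) := by
  classical
  have := hX.isGaussian_map
  have := hY.isGaussian_map
  -- Cramér–Wold: each one-dimensional projection is a centered real Gaussian whose variance is a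
  -- quadratic form in the covariances.
  have key : ∀ L : StrongDual ℝ (ι → ℝ), (P.map (fun ω i => X i ω)).map L =
      (P'.map (fun ω i => Y i ω)).map L := by
    intro L
    rw [AEMeasurable.map_map_of_aemeasurable (by fun_prop) hX.aemeasurable,
      AEMeasurable.map_map_of_aemeasurable (by fun_prop) hY.aemeasurable]
    have e1 : (L ∘ fun ω i => X i ω) = fun ω => ∑ i, L (Pi.single i 1) * X i ω := by
      exact funext fun ω => (strongDual_pi_apply L _).trans
        (Finset.sum_congr rfl fun i _ => mul_comm _ _)
    have e2 : (L ∘ fun ω i => Y i ω) = fun ω => ∑ i, L (Pi.single i 1) * Y i ω := by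
      exact funext fun ω => (strongDual_pi_apply L _).trans
        (Finset.sum_congr rfl fun i _ => mul_comm _ _)
    rw [e1, e2, map_sum_mul_eq_gaussianReal hX hX0, map_sum_mul_eq_gaussianReal hY hY0]
    simp_rw [hcov]
  refine Measure.ext_of_charFunDual (funext fun L => ?_)
  rw [charFunDual_eq_charFun_map_one, charFunDual_eq_charFun_map_one, key]

lemma measure_forall_lt_eq_map [Countable ι] (hX : ∀ i, AEMeasurable (X i) P) (r : ℝ) :
    P {ω | ∀ i, X i ω < r} = P.map (fun ω i => X i ω) {x | ∀ i, x i < r} := by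
  rw [Measure.map_apply_of_aemeasurable (aemeasurable_pi_iff.2 hX)]
  · rfl
  · exact (measurableSet_setOfPred.2 (Measurable.forall fun i =>
      measurableSet_setOfPred.1 (measurableSet_lt (measurable_pi_apply i) measurable_const)))

/-- The law of a countable centered Gaussian family is determined by its covariances. -/
lemma measure_forall_lt_congr [Countable ι] (hX : IsGaussianProcess X P)
    (hY : IsGaussianProcess Y P')
    (hX0 : ∀ i, ∫ ω, X i ω ∂P = 0) (hY0 : ∀ i, ∫ ω, Y i ω ∂P' = 0)
    (hcov : ∀ i j, ∫ ω, X i ω * X j ω ∂P = ∫ ω, Y i ω * Y j ω ∂P') (r : ℝ) :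
    P {ω | ∀ i, X i ω < r} = P' {ω | ∀ i, Y i ω < r} := by
  have hXm := aemeasurable_pi_iff.2 hX.aemeasurable
  have hYm := aemeasurable_pi_iff.2 hY.aemeasurable
  have := hX.isProbabilityMeasure
  have := hY.isProbabilityMeasure
  rw [measure_forall_lt_eq_map hX.aemeasurable, measure_forall_lt_eq_map hY.aemeasurable]
  congr 1
  -- Both laws on the countable product are projective limits of their finite-dimensional marginals.
  -- These agree, and a projective limit is unique.
  have h1 := isProjectiveLimit_map hXm
  have h2 := isProjectiveLimit_map hYm
  have : (fun I : Finset ι => P.map (fun ω => I.restrict (X · ω))) =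
      fun I : Finset ι => P'.map (fun ω => I.restrict (Y · ω)) := by
    funext I
    exact map_eq_of_integral_mul_eq (X := fun i : I => X i) (Y := fun i : I => Y i)
      (hX.hasGaussianLaw I) (hY.hasGaussianLaw I)
      (fun i => hX0 i) (fun i => hY0 i) (fun i j => hcov i j)
  rw [this] at h1
  exact h1.unique h2

end Law

/-! ### Positive association of orthant events -/

/-- Differentiation of a product of one-variable functions along a rotation. -/
lemma hasDerivAt_prod_rotation {ι : Type*} [DecidableEq ι] {ψ ψ' : ℝ → ℝ}
    (hψ : ∀ x, HasDerivAt ψ (ψ' x) x)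
    (G : Finset ι) (x y : ι → ℝ) (θ : ℝ) :
    HasDerivAt (fun θ => ∏ j ∈ G, ψ (Real.cos θ * x j + Real.sin θ * y j))
      (∑ j ∈ G, (∏ i ∈ G.erase j, ψ (Real.cos θ * x i + Real.sin θ * y i)) *
        ψ' (Real.cos θ * x j + Real.sin θ * y j) *
        (-Real.sin θ * x j + Real.cos θ * y j)) θ := by
  have h := HasDerivAt.fun_finsetProd (u := G)
    (f := fun j θ => ψ (Real.cos θ * x j + Real.sin θ * y j))
    (f' := fun j => ψ' (Real.cos θ * x j + Real.sin θ * y j) *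
        (-Real.sin θ * x j + Real.cos θ * y j)) (x := θ) fun j _ =>
      (hψ _).comp θ (((Real.hasDerivAt_cos θ).mul_const _).add
        ((Real.hasDerivAt_sin θ).mul_const _))
  simpa only [smul_eq_mul, mul_assoc] using h

section Association

lemma hasGaussianLaw_coord {ι : Type*} {μ : Measure (ι → ℝ)} [IsGaussian μ] :
    HasGaussianLaw (fun (x : ι → ℝ) i => x i) μ :=
  IsGaussian.hasGaussianLaw_id

lemma integrable_coord {ι : Type*} {μ : Measure (ι → ℝ)} [IsGaussian μ] (j : ι) :
    Integrable (fun x : ι → ℝ => x j) μ :=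
  ((hasGaussianLaw_coord (μ := μ)).eval j).integrable

lemma integrable_coord_mul_of_bounded {ι : Type*} {μ : Measure (ι → ℝ)} [IsGaussian μ]
    {F : (ι → ℝ) → ℝ} (hF : Measurable F)
    (hb : ∀ x, |F x| ≤ 1) (j : ι) : Integrable (fun x => x j * F x) μ :=
  (integrable_coord j).mul_bdd (c := 1) hF.aestronglyMeasurable
    (Eventually.of_forall fun x => by simpa using hb x)

variable {ι : Type*} [Fintype ι] {μ : Measure (ι → ℝ)} [IsGaussian μ]

/-- A centered Gaussian measure is invariant under the reflection in the direction of the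
covariances with the `j`-th coordinate. -/
lemma map_reflection_eq_self (h0 : ∀ i, ∫ x, x i ∂μ = 0) (j : ι) (h1 : ∫ x, x j * x j ∂μ = 1) :
    μ.map (fun u i => u i - 2 * u j * ∫ x, x i * x j ∂μ) = μ := by
  set a : ι → ℝ := fun i => ∫ x, x i * x j ∂μ with ha
  have hid := hasGaussianLaw_coord (μ := μ)
  have hR : HasGaussianLaw (fun (u : ι → ℝ) i => u i - 2 * u j * a i) μ :=
    (IsGaussian.hasGaussianLaw_id (μ := μ)).map_fun (ContinuousLinearMap.pi fun i : ι =>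
      ContinuousLinearMap.proj (R := ℝ) (φ := fun _ : ι => ℝ) i - (2 * a i) •
      ContinuousLinearMap.proj (R := ℝ) (φ := fun _ : ι => ℝ) j) |>.congr
      (Eventually.of_forall fun u => by ext i; simp; ring)
  -- The correction to the covariance of coordinates `i` and `k` is `(-2 - 2 + 4) * a i * a k = 0`,
  -- by unit variance of coordinate `j`.
  have hm := map_eq_of_integral_mul_eq (X := fun i (u : ι → ℝ) => u i - 2 * u j * a i)
    (Y := fun i (u : ι → ℝ) => u i) hR hid ?_ h0 ?_
  · simpa using hm
  · intro i
    rw [integral_sub (integrable_coord i) (((integrable_coord j).const_mul 2).mul_const _),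
      integral_mul_const, integral_const_mul, h0, h0]
    simp
  · intro i k
    have hI := integrable_mul_of_hasGaussianLaw hid
    have e : ∀ u : ι → ℝ, (u i - 2 * u j * a i) * (u k - 2 * u j * a k) =
        u i * u k - (2 * a k) * (u i * u j) - (2 * a i) * (u k * u j)
          + (4 * a i * a k) * (u j * u j) := fun u => by ring
    simp_rw [e]
    have hB := (hI i j).const_mul (2 * a k)
    have hC := (hI k j).const_mul (2 * a i)
    have hAB : Integrable (fun u : ι → ℝ => u i * u k - 2 * a k * (u i * u j)) μ := (hI i k).sub hB
    have hABC : Integrable (fun u : ι → ℝ => u i * u k - 2 * a k * (u i * u j)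
      - 2 * a i * (u k * u j)) μ := hAB.sub hC
    rw [integral_add hABC ((hI j j).const_mul _), integral_sub hAB hC, integral_sub (hI i k) hB,
      integral_const_mul, integral_const_mul, integral_const_mul, h1]
    simp only [ha]
    ring

/-- The reflection `R u = u - 2 u_j a` preserves the measure and flips the sign of `u_j`, so twice
the integral is that of `u_j (F u - F (R u))`. As `u = R u + 2 u_j a`, monotonicity along `a` gives
both factors the same sign. This takes the place of Gaussian integration by parts and needs no
smoothness of `F`, so indicators are allowed. -/
lemma integral_coord_mul_nonneg (h0 : ∀ i, ∫ x, x i ∂μ = 0) (j : ι)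
    (h1 : ∫ x, x j * x j ∂μ = 1) {F : (ι → ℝ) → ℝ} (hF : Measurable F) (hb : ∀ x, |F x| ≤ 1)
    (hmono : ∀ u (t : ℝ), 0 ≤ t → F u ≤ F (fun i => u i + t * ∫ x, x i * x j ∂μ)) :
    0 ≤ ∫ u, u j * F u ∂μ := by
  set a : ι → ℝ := fun i => ∫ x, x i * x j ∂μ with ha
  set R : (ι → ℝ) → ι → ℝ := fun u i => u i - 2 * u j * a i with hR
  have hRm : Measurable R := by fun_prop
  have hmap : μ.map R = μ := map_reflection_eq_self h0 j h1
  have haj : a j = 1 := h1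
  have e : ∫ u, u j * F u ∂μ = ∫ u, -(u j * F (R u)) ∂μ := by
    conv_lhs => rw [← hmap]
    rw [integral_map hRm.aemeasurable (by fun_prop)]
    refine integral_congr_ae (Eventually.of_forall fun u => ?_)
    simp only [hR, haj]; ring
  have hi1 := integrable_coord_mul_of_bounded (μ := μ) hF hb j
  have hi2 : Integrable (fun u => -(u j * F (R u))) μ :=
    (integrable_coord_mul_of_bounded (μ := μ) (hF.comp hRm) (fun x => hb _) j).neg
  have : 0 ≤ ∫ u, (u j * F u + -(u j * F (R u))) ∂μ := by
    refine integral_nonneg fun u => ?_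
    change 0 ≤ u j * F u + -(u j * F (R u))
    rcases le_total 0 (u j) with h | h
    · have := hmono (R u) (2 * u j) (by positivity)
      have e2 : (fun i => R u i + 2 * u j * ∫ x, x i * x j ∂μ) = u := by
        ext i; simp [hR, ha]
      rw [e2] at this
      nlinarith
    · have := hmono u (-(2 * u j)) (by linarith)
      have e2 : (fun i => u i + -(2 * u j) * ∫ x, x i * x j ∂μ) = R u := by
        ext i; simp [hR, ha]; ring
      rw [e2] at this
      nlinarith
  rw [integral_add hi1 hi2, ← e] at this
  linarith

lemma map_rotation_prod_eq_self (h0 : ∀ i, ∫ x, x i ∂μ = 0) (θ : ℝ) :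
    (μ.prod μ).map (fun p => (fun i => Real.cos θ * p.1 i + Real.sin θ * p.2 i,
      fun i => -Real.sin θ * p.1 i + Real.cos θ * p.2 i)) = μ.prod μ := by
  refine IsGaussian.map_rotation_eq_self (μ := μ) ?_ θ
  ext i
  have := ContinuousLinearMap.integral_comp_comm
    (ContinuousLinearMap.proj (R := ℝ) (φ := fun _ : ι => ℝ) i) (IsGaussian.integrable_id (μ := μ))
  simp only [ContinuousLinearMap.proj_apply, id_eq, h0] at this
  exact this.symm

/-- Smooth form of the association inequality for centered Gaussian vectors. -/
lemma integral_mul_integral_le_of_smooth [DecidableEq ι] (h0 : ∀ i, ∫ x, x i ∂μ = 0)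
    (h1 : ∀ i, ∫ x, x i * x i ∂μ = 1) (G : Finset ι) {f : (ι → ℝ) → ℝ} (hf : Measurable f)
    (hf0 : ∀ x, 0 ≤ f x) (hf1 : ∀ x, f x ≤ 1)
    (hanti : ∀ j ∈ G, ∀ u (t : ℝ), 0 ≤ t → f (fun i => u i + t * ∫ x, x i * x j ∂μ) ≤ f u)
    {ψ ψ' : ℝ → ℝ} (hψ : ∀ x, HasDerivAt ψ (ψ' x) x) (hψ0 : ∀ x, 0 ≤ ψ x) (hψ1 : ∀ x, ψ x ≤ 1)
    (hψ'm : Measurable ψ') {C : ℝ} (hψ'0 : ∀ x, ψ' x ≤ 0) (hψ'C : ∀ x, -C ≤ ψ' x) :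
    (∫ x, f x ∂μ) * ∫ x, ∏ j ∈ G, ψ (x j) ∂μ ≤ ∫ x, f x * ∏ j ∈ G, ψ (x j) ∂μ := by
  have hψm : Measurable ψ :=
    (continuous_iff_continuousAt.2 fun x => (hψ x).continuousAt).measurable
  have hP0 : ∀ (s : Finset ι) (x : ι → ℝ), 0 ≤ ∏ i ∈ s, ψ (x i) := fun s x =>
    Finset.prod_nonneg fun i _ => hψ0 _
  have hP1 : ∀ (s : Finset ι) (x : ι → ℝ), ∏ i ∈ s, ψ (x i) ≤ 1 := fun s x =>
    Finset.prod_le_one (fun i _ => hψ0 _) fun i _ => hψ1 _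
  set Dg : ι → (ι → ℝ) → ℝ := fun j v => (∏ i ∈ G.erase j, ψ (v i)) * ψ' (v j) with hDg
  have hDgm : ∀ j, Measurable (Dg j) := fun j => by fun_prop
  have hDg0 : ∀ j v, Dg j v ≤ 0 := fun j v => mul_nonpos_of_nonneg_of_nonpos (hP0 _ _) (hψ'0 _)
  have hDgC : ∀ j v, |Dg j v| ≤ C := fun j v => by
    rw [abs_mul, abs_of_nonneg (hP0 _ _), abs_of_nonpos (hψ'0 _)]
    have h1 := hP1 (G.erase j) v
    have h2 := hψ'C (v j)
    have h3 := hψ'0 (v j)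
    nlinarith [hP0 (G.erase j) v]
  -- `V θ` moves from the first of two independent copies at `θ = 0` to the second at `θ = π / 2`,
  -- with velocity `U θ`. Hence `φ` interpolates between the joint expectation and the product of
  -- expectations.
  set V : ℝ → (ι → ℝ) × (ι → ℝ) → ι → ℝ := fun θ p i =>
    Real.cos θ * p.1 i + Real.sin θ * p.2 i with hV
  set U : ℝ → (ι → ℝ) × (ι → ℝ) → ι → ℝ := fun θ p i =>
    -Real.sin θ * p.1 i + Real.cos θ * p.2 i with hU
  have hVm : ∀ θ, Measurable (V θ) := fun θ => by fun_prop
  have hUm : ∀ θ, Measurable (U θ) := fun θ => by fun_prop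
  set φ : ℝ → ℝ := fun θ => ∫ p, f p.1 * ∏ j ∈ G, ψ (V θ p j) ∂(μ.prod μ) with hφ
  set φ' : ℝ → ℝ := fun θ => ∫ p, f p.1 * ∑ j ∈ G, Dg j (V θ p) * U θ p j ∂(μ.prod μ) with hφ'
  have hi1 : ∀ j, Integrable (fun p : (ι → ℝ) × (ι → ℝ) => |p.1 j|) (μ.prod μ) := fun j =>
    ((integrable_coord (μ := μ) j).comp_fst μ).abs
  have hi2 : ∀ j, Integrable (fun p : (ι → ℝ) × (ι → ℝ) => |p.2 j|) (μ.prod μ) := fun j =>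
    ((integrable_coord (μ := μ) j).comp_snd μ).abs
  have hUb : ∀ θ p j, |U θ p j| ≤ |p.1 j| + |p.2 j| := fun θ p j => by
    refine (abs_add_le _ _).trans (add_le_add ?_ ?_) <;> rw [abs_mul]
    · rw [abs_neg]
      exact mul_le_of_le_one_left (abs_nonneg _) (Real.abs_sin_le_one θ)
    · exact mul_le_of_le_one_left (abs_nonneg _) (Real.abs_cos_le_one θ)
  have hderiv : ∀ θ, HasDerivAt φ (φ' θ) θ := by
    intro θ
    refine (hasDerivAt_integral_of_dominated_loc_of_deriv_le (s := Set.univ)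
      (bound := fun p => ∑ j ∈ G, C * (|p.1 j| + |p.2 j|))
      (F := fun θ p => f p.1 * ∏ j ∈ G, ψ (V θ p j))
      (F' := fun θ p => f p.1 * ∑ j ∈ G, Dg j (V θ p) * U θ p j)
      univ_mem (Eventually.of_forall fun θ => ?_) ?_ ?_ ?_ ?_ ?_).2
    · exact Measurable.aestronglyMeasurable (by fun_prop)
    · refine Integrable.of_bound (Measurable.aestronglyMeasurable (by fun_prop)) 1
        (Eventually.of_forall fun p => ?_)
      rw [Real.norm_eq_abs, abs_of_nonneg (mul_nonneg (hf0 _) (hP0 _ _))]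
      exact mul_le_one₀ (hf1 _) (hP0 _ _) (hP1 _ _)
    · exact Measurable.aestronglyMeasurable (by fun_prop)
    · refine Eventually.of_forall fun p θ _ => ?_
      rw [Real.norm_eq_abs, abs_mul, abs_of_nonneg (hf0 _)]
      refine (mul_le_of_le_one_left (abs_nonneg _) (hf1 _)).trans
        ((Finset.abs_sum_le_sum_abs _ _).trans (Finset.sum_le_sum fun j _ => ?_))
      rw [abs_mul]
      exact mul_le_mul (hDgC _ _) (hUb _ _ _) (abs_nonneg _) ((abs_nonneg _).trans (hDgC j p.1))
    · exact integrable_finsetSum _ fun j _ => ((hi1 j).add (hi2 j)).const_mul C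
    · exact Eventually.of_forall fun p θ _ =>
        (hasDerivAt_prod_rotation hψ G p.1 p.2 θ).const_mul (f p.1)
  have hneg : ∀ θ, 0 ≤ Real.sin θ → φ' θ ≤ 0 := by
    intro θ hs
    -- The rotated pair `(V, U)` is again an independent pair with the same law, and the first copy
    -- is `cos θ V - sin θ U`. In these coordinates `Dg j` depends on the first component only, so
    -- one can integrate over the second first.
    set H : (ι → ℝ) × (ι → ℝ) → ℝ := fun q =>
      f (fun i => Real.cos θ * q.1 i - Real.sin θ * q.2 i) * ∑ j ∈ G, Dg j q.1 * q.2 j with hH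
    have hHm : Measurable H := by fun_prop
    have e : φ' θ = ∫ q, H q ∂(μ.prod μ) := by
      conv_rhs => rw [← map_rotation_prod_eq_self h0 θ]
      rw [integral_map (Measurable.aemeasurable (by fun_prop)) hHm.aestronglyMeasurable]
      refine integral_congr_ae (Eventually.of_forall fun p => ?_)
      simp only [hH, hV, hU]
      congr 2
      ext i
      linear_combination (-p.1 i) * Real.sin_sq_add_cos_sq θ
    have hHi : Integrable H (μ.prod μ) := by
      refine Integrable.mono' (g := fun p => ∑ j ∈ G, C * |p.2 j|)
        (integrable_finsetSum _ fun j _ => (hi2 j).const_mul C) hHm.aestronglyMeasurable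
        (Eventually.of_forall fun p => ?_)
      rw [Real.norm_eq_abs, abs_mul, abs_of_nonneg (hf0 _)]
      refine (mul_le_of_le_one_left (abs_nonneg _) (hf1 _)).trans
        ((Finset.abs_sum_le_sum_abs _ _).trans (Finset.sum_le_sum fun j _ => ?_))
      rw [abs_mul]
      exact mul_le_mul_of_nonneg_right (hDgC _ _) (abs_nonneg _)
    rw [e, integral_prod _ hHi]
    refine integral_nonpos fun v => ?_
    set F : (ι → ℝ) → ℝ := fun u => f (fun i => Real.cos θ * v i - Real.sin θ * u i) with hF
    have hFm : Measurable F := by fun_prop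
    have hFb : ∀ u, |F u| ≤ 1 := fun u => abs_le.2 ⟨by linarith [hf0 (fun i =>
      Real.cos θ * v i - Real.sin θ * u i)], hf1 _⟩
    have e2 : ∀ u, H (v, u) = ∑ j ∈ G, Dg j v * (u j * F u) := fun u => by
      simp only [hH, hF, Finset.mul_sum]
      exact Finset.sum_congr rfl fun j _ => by ring
    simp only [e2]
    rw [integral_finsetSum _ fun j _ => (integrable_coord_mul_of_bounded hFm hFb j).const_mul _]
    refine Finset.sum_nonpos fun j hj => ?_
    rw [integral_const_mul]
    -- Since `f` is nonincreasing along the covariance direction and `sin θ ≥ 0`, the function `F`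
    -- is nondecreasing along it.
    refine mul_nonpos_of_nonpos_of_nonneg (hDg0 _ _)
      (integral_coord_mul_nonneg h0 j (h1 j) hFm hFb fun u t ht => ?_)
    have := hanti j hj (fun i => Real.cos θ * v i - Real.sin θ *
      (u i + t * ∫ x, x i * x j ∂μ)) (Real.sin θ * t) (mul_nonneg hs ht)
    refine le_trans (le_of_eq ?_) this
    simp only [hF]
    congr 1
    ext i
    ring
  have hanti' : AntitoneOn φ (Set.Icc 0 (Real.pi / 2)) := by
    refine antitoneOn_of_deriv_nonpos (convex_Icc _ _)
      (fun θ _ => (hderiv θ).continuousAt.continuousWithinAt)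
      (fun θ _ => (hderiv θ).differentiableAt.differentiableWithinAt) fun θ hθ => ?_
    rw [interior_Icc] at hθ
    rw [(hderiv θ).deriv]
    exact hneg θ (Real.sin_nonneg_of_nonneg_of_le_pi hθ.1.le (by linarith [hθ.2, Real.pi_pos]))
  have hle : φ (Real.pi / 2) ≤ φ 0 := hanti' ⟨le_rfl, Real.pi_div_two_pos.le⟩
    ⟨Real.pi_div_two_pos.le, le_rfl⟩ Real.pi_div_two_pos.le
  have e0 : φ 0 = ∫ x, f x * ∏ j ∈ G, ψ (x j) ∂μ := by
    simp only [hφ, hV, Real.cos_zero, Real.sin_zero, one_mul, zero_mul, add_zero]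
    exact integral_fun_fst (μ := μ) (ν := μ) (fun x => f x * ∏ j ∈ G, ψ (x j)) |>.trans (by simp)
  have e1 : φ (Real.pi / 2) = (∫ x, f x ∂μ) * ∫ x, ∏ j ∈ G, ψ (x j) ∂μ := by
    simp only [hφ, hV, Real.cos_pi_div_two, Real.sin_pi_div_two, one_mul, zero_mul, zero_add]
    exact integral_prod_mul (μ := μ) (ν := μ) f (fun x => ∏ j ∈ G, ψ (x j))
  rwa [e0, e1] at hle

end Association

/-- The slope `n ^ 2` beats the shift `n` to the left of `r`, while the shift alone forces the limit
0 at `x = r`. The limit is thus the indicator of the strict inequality. -/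
lemma tendsto_sigmoid_indicator (r x : ℝ) :
    Tendsto (fun n : ℕ => Real.sigmoid ((n : ℝ) ^ 2 * (r - x) - n)) atTop
      (𝓝 (if x < r then 1 else 0)) := by
  have hn : Tendsto (fun n : ℕ => (n : ℝ)) atTop atTop := tendsto_natCast_atTop_atTop
  have e : ∀ n : ℕ, (n : ℝ) ^ 2 * (r - x) - n = n * (n * (r - x) - 1) := fun n => by ring
  split_ifs with h
  · refine Real.tendsto_sigmoid_atTop.comp ?_
    simp_rw [e]
    exact hn.atTop_mul_atTop₀ (tendsto_atTop_add_const_right _ _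
      (hn.atTop_mul_const (sub_pos.2 h)))
  · refine Real.tendsto_sigmoid_atBot.comp ?_
    refine tendsto_atBot_mono (fun n => ?_) (tendsto_neg_atTop_atBot.comp hn)
    have : (n : ℝ) ^ 2 * (r - x) ≤ 0 :=
      mul_nonpos_of_nonneg_of_nonpos (sq_nonneg _) (by linarith)
    simp only [Function.comp_apply]
    linarith

lemma measurableSet_forall_mem_lt {ι : Type*} [Countable ι] (S : Set ι) (r : ℝ) :
    MeasurableSet {x : ι → ℝ | ∀ i ∈ S, x i < r} := by
  have : {x : ι → ℝ | ∀ i ∈ S, x i < r} = ⋂ i ∈ S, {x | x i < r} := by ext; simp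
  rw [this]
  exact MeasurableSet.biInter (Set.to_countable S) fun i _ =>
    measurableSet_lt (measurable_pi_apply i) measurable_const

/-- Orthant probabilities of a centered Gaussian vector with nonnegative covariances are
positively associated. -/
lemma orthant_mul_orthant_le {ι : Type*} [Fintype ι] {μ : Measure (ι → ℝ)} [IsGaussian μ]
    (h0 : ∀ i, ∫ x, x i ∂μ = 0) (h1 : ∀ i, ∫ x, x i * x i ∂μ = 1)
    (hpos : ∀ i j, 0 ≤ ∫ x, x i * x j ∂μ) (F G : Finset ι) (r : ℝ) :
    μ.real {x | ∀ i ∈ F, x i < r} * μ.real {x | ∀ i ∈ G, x i < r} ≤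
      μ.real ({x | ∀ i ∈ F, x i < r} ∩ {x | ∀ i ∈ G, x i < r}) := by
  classical
  set SF := {x : ι → ℝ | ∀ i ∈ F, x i < r} with hSF
  set SG := {x : ι → ℝ | ∀ i ∈ G, x i < r} with hSG
  have hF : MeasurableSet SF := measurableSet_forall_mem_lt (F : Set ι) r
  have hG : MeasurableSet SG := measurableSet_forall_mem_lt (G : Set ι) r
  set f : (ι → ℝ) → ℝ := SF.indicator 1 with hf
  have hfm : Measurable f := measurable_one.indicator hF
  have hf0 : ∀ x, 0 ≤ f x := fun x => Set.indicator_nonneg (fun _ _ => zero_le_one) x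
  have hf1 : ∀ x, f x ≤ 1 := fun x => Set.indicator_le_self' (fun _ _ => zero_le_one) x
  set ψ : ℕ → ℝ → ℝ := fun n x => Real.sigmoid ((n : ℝ) ^ 2 * (r - x) - n) with hψ
  have hψm : ∀ n, Measurable (ψ n) := fun n =>
    (continuous_sigmoid.comp (by fun_prop)).measurable
  have hψd : ∀ n x, HasDerivAt (ψ n) (Real.sigmoid ((n : ℝ) ^ 2 * (r - x) - n) *
      (1 - Real.sigmoid ((n : ℝ) ^ 2 * (r - x) - n)) * (-(n : ℝ) ^ 2)) x := fun n x => by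
    have : HasDerivAt (fun x : ℝ => (n : ℝ) ^ 2 * (r - x) - n) (-(n : ℝ) ^ 2) x := by
      simpa using (((hasDerivAt_id x).const_sub r).const_mul ((n : ℝ) ^ 2)).sub_const (n : ℝ)
    exact (Real.hasDerivAt_sigmoid _).comp x this
  have hs : ∀ y, 0 ≤ Real.sigmoid y * (1 - Real.sigmoid y) ∧
      Real.sigmoid y * (1 - Real.sigmoid y) ≤ 1 := fun y => by
    have h1 := Real.sigmoid_nonneg y
    have h2 := Real.sigmoid_le_one y
    constructor <;> nlinarith
  -- Only the second indicator is smoothed. The first enters as `f`, for which boundedness,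
  -- measurability and monotonicity suffice.
  have key : ∀ n, (∫ x, f x ∂μ) * ∫ x, ∏ j ∈ G, ψ n (x j) ∂μ ≤
      ∫ x, f x * ∏ j ∈ G, ψ n (x j) ∂μ := fun n => by
    refine integral_mul_integral_le_of_smooth (C := (n : ℝ) ^ 2) h0 h1 G hfm hf0 hf1 ?_ (hψd n)
      (fun x => Real.sigmoid_nonneg _) (fun x => Real.sigmoid_le_one _) ?_ ?_ ?_
    · intro j _ u t ht
      by_cases h : (fun i => u i + t * ∫ x, x i * x j ∂μ) ∈ SF
      · have h' : u ∈ SF := fun i hi => by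
          have := h i hi
          have h2 := mul_nonneg ht (hpos i j)
          linarith
        simp [hf, h, h']
      · simpa [hf, h] using hf0 u
    · have := continuous_sigmoid
      exact Continuous.measurable (by fun_prop)
    · intro x
      nlinarith [(hs ((n : ℝ) ^ 2 * (r - x) - n)).1, sq_nonneg (n : ℝ)]
    · intro x
      nlinarith [(hs ((n : ℝ) ^ 2 * (r - x) - n)).2, sq_nonneg (n : ℝ)]
  have hlim : ∀ x : ι → ℝ, Tendsto (fun n => ∏ j ∈ G, ψ n (x j)) atTop
      (𝓝 (SG.indicator 1 x)) := fun x => by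
    have := tendsto_finsetProd G fun j _ => tendsto_sigmoid_indicator r (x j)
    convert this using 2
    rw [Finset.prod_ite_zero]
    simp [Set.indicator_apply, hSG]
  have hP0 : ∀ n (x : ι → ℝ), 0 ≤ ∏ i ∈ G, ψ n (x i) := fun n x =>
    Finset.prod_nonneg fun i _ => Real.sigmoid_nonneg _
  have hP1 : ∀ n (x : ι → ℝ), ∏ i ∈ G, ψ n (x i) ≤ 1 := fun n x =>
    Finset.prod_le_one (fun i _ => Real.sigmoid_nonneg _) fun i _ => Real.sigmoid_le_one _
  have l1 : Tendsto (fun n => ∫ x, ∏ j ∈ G, ψ n (x j) ∂μ) atTop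
      (𝓝 (∫ x, SG.indicator 1 x ∂μ)) := by
    refine tendsto_integral_of_dominated_convergence (fun _ => 1)
      (fun n => Measurable.aestronglyMeasurable (by fun_prop)) (integrable_const _)
      (fun n => Eventually.of_forall fun x => ?_) (Eventually.of_forall hlim)
    rw [Real.norm_eq_abs, abs_of_nonneg (hP0 n x)]
    exact hP1 n x
  have l2 : Tendsto (fun n => ∫ x, f x * ∏ j ∈ G, ψ n (x j) ∂μ) atTop
      (𝓝 (∫ x, f x * SG.indicator 1 x ∂μ)) := by
    refine tendsto_integral_of_dominated_convergence (fun _ => 1)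
      (fun n => Measurable.aestronglyMeasurable (by fun_prop)) (integrable_const _)
      (fun n => Eventually.of_forall fun x => ?_)
      (Eventually.of_forall fun x => (hlim x).const_mul _)
    rw [Real.norm_eq_abs, abs_of_nonneg (mul_nonneg (hf0 x) (hP0 n x))]
    exact mul_le_one₀ (hf1 x) (hP0 n x) (hP1 n x)
  have h := le_of_tendsto_of_tendsto' (l1.const_mul (∫ x, f x ∂μ)) l2 key
  have e : ∀ x, f x * SG.indicator 1 x = (SF ∩ SG).indicator 1 x := fun x => by
    rw [hf, Set.inter_indicator_one]; rfl
  simp_rw [e] at h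
  rwa [hf, integral_indicator_one hF, integral_indicator_one hG,
    integral_indicator_one (hF.inter hG)] at h

section

variable {T Ω : Type*} [MeasurableSpace Ω] {P : Measure Ω} {Z : T → Ω → ℝ}

lemma nullMeasurableSet_forall_lt (hZ : ∀ t, AEMeasurable (Z t) P) {S : Set T}
    (hS : S.Countable) (r : ℝ) : NullMeasurableSet {ω | ∀ t ∈ S, Z t ω < r} P := by
  have : {ω | ∀ t ∈ S, Z t ω < r} = ⋂ t ∈ S, {ω | Z t ω < r} := by ext; simp
  rw [this]
  exact NullMeasurableSet.biInter hS fun t _ => nullMeasurableSet_lt (hZ t) aemeasurable_const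

/-- Continuity from above along the directed family of finite subsets. It reduces countable time
sets to Gaussian vectors. -/
lemma le_measure_forall_lt_of_finset [IsFiniteMeasure P] (hZ : ∀ t, AEMeasurable (Z t) P)
    {S : Set T} (hS : S.Countable) {r : ℝ} {c : ℝ≥0∞}
    (h : ∀ I : Finset T, (I : Set T) ⊆ S → c ≤ P {ω | ∀ t ∈ I, Z t ω < r}) :
    c ≤ P {ω | ∀ t ∈ S, Z t ω < r} := by
  classical
  have := hS.to_subtype
  have e : {ω | ∀ t ∈ S, Z t ω < r} = ⋂ I : Finset S, {ω | ∀ t ∈ I, Z t ω < r} := by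
    ext ω
    simp only [Set.mem_ofPred_eq, Set.mem_iInter]
    exact ⟨fun h I t _ => h t t.2, fun h t ht => h {⟨t, ht⟩} ⟨t, ht⟩ (by simp)⟩
  rw [e, Directed.measure_iInter]
  · refine le_iInf fun I => ?_
    have := h (I.map (Function.Embedding.subtype _)) (by intro t; simp; tauto)
    simpa using this
  · intro I
    exact nullMeasurableSet_forall_lt (Z := fun t : S => Z t) (fun t => hZ t) I.countable_toSet r
  · refine directed_of_isDirected_le fun I J hIJ ω h t ht => h t (Finset.mem_of_subset hIJ ht)
  · exact ⟨∅, measure_ne_top _ _⟩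

/-- Association of a Gaussian process with nonnegative covariances. -/
lemma measure_forall_lt_mul_le (hZ : IsGaussianProcess Z P) (h0 : ∀ t, ∫ ω, Z t ω ∂P = 0)
    (h1 : ∀ t, ∫ ω, Z t ω * Z t ω ∂P = 1) (hpos : ∀ s t, 0 ≤ ∫ ω, Z s ω * Z t ω ∂P)
    {S S' : Set T} (hS : S.Countable) (hS' : S'.Countable) (r : ℝ) :
    P {ω | ∀ t ∈ S, Z t ω < r} * P {ω | ∀ t ∈ S', Z t ω < r} ≤
      P {ω | ∀ t ∈ S ∪ S', Z t ω < r} := by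
  classical
  have := hZ.isProbabilityMeasure
  refine le_measure_forall_lt_of_finset hZ.aemeasurable (hS.union hS') fun I hI => ?_
  have hlaw := hZ.hasGaussianLaw I
  set μ := P.map (fun ω => I.restrict (Z · ω)) with hμ
  have hμG : IsGaussian μ := hlaw.isGaussian_map
  have hmap : ∀ {g : (I → ℝ) → ℝ}, Measurable g → ∫ x, g x ∂μ = ∫ ω, g (I.restrict (Z · ω)) ∂P :=
    fun hg => integral_map hlaw.aemeasurable hg.aestronglyMeasurable
  set F : Finset I := Finset.univ.filter fun i => (i : T) ∈ S with hF
  set G : Finset I := Finset.univ.filter fun i => (i : T) ∈ S' with hG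
  have key := orthant_mul_orthant_le (μ := μ)
    (fun i => by rw [hmap (measurable_pi_apply i)]; exact h0 i)
    (fun i => by rw [hmap (by fun_prop)]; exact h1 i)
    (fun i j => by rw [hmap (by fun_prop)]; exact hpos i j) F G r
  have hset : ∀ H : Finset I, MeasurableSet {x : I → ℝ | ∀ i ∈ H, x i < r} := fun H =>
    measurableSet_forall_mem_lt (H : Set I) r
  rw [measureReal_def, measureReal_def, measureReal_def, ← ENNReal.toReal_mul,
    ENNReal.toReal_le_toReal (ENNReal.mul_ne_top (measure_ne_top _ _) (measure_ne_top _ _))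
      (measure_ne_top _ _), hμ, Measure.map_apply_of_aemeasurable hlaw.aemeasurable (hset F),
    Measure.map_apply_of_aemeasurable hlaw.aemeasurable (hset G),
    Measure.map_apply_of_aemeasurable hlaw.aemeasurable ((hset F).inter (hset G))] at key
  refine (mul_le_mul' (measure_mono ?_) (measure_mono ?_)).trans (key.trans (measure_mono ?_))
  · intro ω h i hi
    exact h i (by simpa [hF] using hi)
  · intro ω h i hi
    exact h i (by simpa [hG] using hi)
  · rintro ω ⟨hω, hω'⟩ t ht
    rcases hI ht with h | h
    · exact hω ⟨t, ht⟩ (by simpa [hF] using h)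
    · exact hω' ⟨t, ht⟩ (by simpa [hG] using h)

end

/-! ### Exponential decay of orthants of weakly correlated vectors -/

/-- The cross terms factor and vanish because `a` and `a'` are centered. This gives the covariances
of the independent sums used in the decompositions below. -/
lemma integral_add_mul_add_prod {α β : Type*} [MeasurableSpace α] [MeasurableSpace β]
    {μ : Measure α} {ν : Measure β} [IsProbabilityMeasure μ] [IsProbabilityMeasure ν]
    {a a' : α → ℝ} {b b' : β → ℝ} (ha : MemLp a 2 μ) (ha' : MemLp a' 2 μ) (hb : MemLp b 2 ν)
    (hb' : MemLp b' 2 ν) (ha0 : ∫ x, a x ∂μ = 0) (ha0' : ∫ x, a' x ∂μ = 0) :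
    ∫ p, (a p.1 + b p.2) * (a' p.1 + b' p.2) ∂(μ.prod ν) =
      ∫ x, a x * a' x ∂μ + ∫ y, b y * b' y ∂ν := by
  have i1 : Integrable (fun p : α × β => a p.1 * a' p.1) (μ.prod ν) :=
    (ha.integrable_mul ha').comp_fst ν
  have i2 : Integrable (fun p : α × β => b p.2 * b' p.2) (μ.prod ν) :=
    (hb.integrable_mul hb').comp_snd μ
  have i3 : Integrable (fun p : α × β => a p.1 * b' p.2) (μ.prod ν) :=
    (ha.integrable one_le_two).mul_prod (hb'.integrable one_le_two)
  have i4 : Integrable (fun p : α × β => a' p.1 * b p.2) (μ.prod ν) :=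
    (ha'.integrable one_le_two).mul_prod (hb.integrable one_le_two)
  have e : ∀ p : α × β, (a p.1 + b p.2) * (a' p.1 + b' p.2) =
      (a p.1 * a' p.1 + b p.2 * b' p.2) + (a p.1 * b' p.2 + a' p.1 * b p.2) := fun p => by ring
  have i12 : Integrable (fun p : α × β => a p.1 * a' p.1 + b p.2 * b' p.2) (μ.prod ν) := i1.add i2
  have i34 : Integrable (fun p : α × β => a p.1 * b' p.2 + a' p.1 * b p.2) (μ.prod ν) := i3.add i4
  simp_rw [e]
  rw [integral_add i12 i34, integral_add i1 i2, integral_add i3 i4,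
    integral_prod_mul, integral_prod_mul, ha0, ha0',
    integral_fun_fst (μ := μ) (ν := ν) (fun x => a x * a' x),
    integral_fun_snd (μ := μ) (ν := ν) (fun x => b x * b' x)]
  simp

lemma gaussianReal_Iio_lt_one (y : ℝ) : (gaussianReal 0 1).real (Set.Iio y) < 1 := by
  have h : gaussianReal 0 1 (Set.Ici y) ≠ 0 := fun h => by
    have := gaussianReal_absolutelyContinuous' 0 one_ne_zero h
    simp at this
  have h2 := prob_compl_eq_one_sub (μ := gaussianReal 0 1) (measurableSet_Ici (a := y))
  rw [Set.compl_Ici] at h2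
  rw [measureReal_def, h2, ← ENNReal.toReal_one, ENNReal.toReal_lt_toReal (by simp) (by simp)]
  exact ENNReal.sub_lt_self (by simp) (by simp) h

/-- An exponential bound on the Gaussian distribution function which is nontrivial everywhere on
the left of a given point. -/
lemma exists_gaussianReal_Iio_le_exp {b : ℝ} (hb : 0 < b) :
    ∃ β : ℝ, 0 < β ∧ β ≤ 1 / 4 ∧
      ∀ y, (gaussianReal 0 1).real (Set.Iio y) ≤ Real.exp (-β * (b - y)) := by
  set γ := gaussianReal 0 1 with hγ
  have hq1 := gaussianReal_Iio_lt_one b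
  have hqn : 0 ≤ γ.real (Set.Iio b) := measureReal_nonneg
  obtain ⟨q, hq, hq0, hq1⟩ : ∃ q, γ.real (Set.Iio b) ≤ q ∧ 0 < q ∧ q < 1 := by
    obtain ⟨q, h1, h2⟩ := exists_between hq1
    exact ⟨q, h1.le, hqn.trans_lt h1, h2⟩
  have hlog : 0 < -Real.log q := by
    have := Real.log_neg hq0 hq1
    linarith
  -- For `y ≤ -1` the Chernoff bound `exp (y + 1 / 2)` suffices by `β ≤ 1 / 4` and `β b ≤ 1 / 4`.
  -- For `-1 ≤ y ≤ b` the probability is at most `q`, and `β (b + 1) ≤ -log q`. For `y ≥ b` the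
  -- right-hand side is at least 1.
  refine ⟨min (1 / 4) (min (1 / (4 * b)) (-Real.log q / (b + 1))), by positivity,
    min_le_left _ _, fun y => ?_⟩
  set β := min (1 / 4) (min (1 / (4 * b)) (-Real.log q / (b + 1))) with hβ
  have hβ0 : 0 < β := by positivity
  have hβ1 : β ≤ 1 / 4 := min_le_left _ _
  have hβ2 : β * b ≤ 1 / 4 := by
    have : β ≤ 1 / (4 * b) := (min_le_right _ _).trans (min_le_left _ _)
    rw [le_div_iff₀ (by positivity)] at this
    linarith
  have hβ3 : β * (b + 1) ≤ -Real.log q := by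
    have : β ≤ -Real.log q / (b + 1) := (min_le_right _ _).trans (min_le_right _ _)
    rwa [le_div_iff₀ (by positivity)] at this
  rcases le_total b y with h | h
  · exact measureReal_le_one.trans (Real.one_le_exp (by nlinarith))
  rcases le_total (-1) y with h' | h'
  · calc γ.real (Set.Iio y) ≤ γ.real (Set.Iio b) :=
          measureReal_mono (Set.Iio_subset_Iio h)
      _ ≤ q := hq
      _ = Real.exp (Real.log q) := (Real.exp_log hq0).symm
      _ ≤ _ := Real.exp_le_exp.2 (by nlinarith)
  · have hm := measure_le_le_exp_mul_mgf (μ := γ) (X := id) (t := -1) y (by norm_num)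
      (by simpa using integrable_exp_mul_gaussianReal (μ := 0) (v := 1) (-1))
    rw [hγ, mgf_id_gaussianReal] at hm
    calc γ.real (Set.Iio y) ≤ γ.real {ω | id ω ≤ y} :=
          measureReal_mono fun x (hx : x < y) => hx.le
      _ ≤ _ := hm
      _ = Real.exp (y + 1 / 2) := by
        rw [← Real.exp_add]; congr 1; push_cast; ring
      _ ≤ _ := Real.exp_le_exp.2 (by nlinarith)

section Multivariate

variable {ι : Type*} [Fintype ι] [DecidableEq ι] {S : Matrix ι ι ℝ}

lemma integral_eval_multivariateGaussian (i : ι) :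
    ∫ x, x i ∂(multivariateGaussian 0 S) = 0 := by
  have := ContinuousLinearMap.integral_comp_comm
    (EuclideanSpace.proj i : EuclideanSpace ℝ ι →L[ℝ] ℝ)
    (IsGaussian.integrable_id (μ := multivariateGaussian 0 S))
  simpa using this

lemma memLp_eval_multivariateGaussian (i : ι) :
    MemLp (fun x : EuclideanSpace ℝ ι => x i) 2 (multivariateGaussian 0 S) :=
  (IsGaussian.hasGaussianLaw_id.map_fun
    (EuclideanSpace.proj i : EuclideanSpace ℝ ι →L[ℝ] ℝ)).memLp_two

lemma integral_eval_mul_eval_multivariateGaussian (hS : S.PosSemidef) (i j : ι) :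
    ∫ x, x i * x j ∂(multivariateGaussian 0 S) = S i j := by
  have h := covariance_eval_multivariateGaussian (μ := 0) hS i j
  rw [covariance_eq_sub (memLp_eval_multivariateGaussian i) (memLp_eval_multivariateGaussian j),
    integral_eval_multivariateGaussian] at h
  simpa using h

/-- A symmetric matrix with nonnegative off-diagonal entries that is diagonally dominant is
positive semidefinite. -/
lemma posSemidef_of_sum_offDiag_le (hS : ∀ i j, S i j = S j i) (hpos : ∀ i j, i ≠ j → 0 ≤ S i j)
    (hdom : ∀ i, ∑ j ∈ Finset.univ.erase i, S i j ≤ S i i) : S.PosSemidef := by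
  refine Matrix.PosSemidef.of_dotProduct_mulVec_nonneg
    (by ext i j; simpa using hS j i) fun x => ?_
  simp only [star_trivial, dotProduct, Matrix.mulVec, Finset.mul_sum]
  have hrow : ∀ i, ∑ j, x i * (S i j * x j) =
      S i i * x i ^ 2 + ∑ j ∈ Finset.univ.erase i, S i j * (x i * x j) := fun i => by
    rw [← Finset.add_sum_erase _ _ (Finset.mem_univ i)]
    congr 1
    · ring
    · exact Finset.sum_congr rfl fun j _ => by ring
  have hlow : ∀ i, ∑ j ∈ Finset.univ.erase i, S i j * (x i * x j) ≥
      -(1 / 2) * (∑ j ∈ Finset.univ.erase i, S i j * x i ^ 2) -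
        (1 / 2) * ∑ j ∈ Finset.univ.erase i, S i j * x j ^ 2 := fun i => by
    rw [Finset.mul_sum, Finset.mul_sum, ← Finset.sum_sub_distrib]
    refine Finset.sum_le_sum fun j hj => ?_
    nlinarith [mul_nonneg (hpos i j (Finset.ne_of_mem_erase hj).symm) (sq_nonneg (x i + x j))]
  have hswap : ∑ i, ∑ j ∈ Finset.univ.erase i, S i j * x j ^ 2 =
      ∑ i, ∑ j ∈ Finset.univ.erase i, S i j * x i ^ 2 := by
    have e : ∀ i, (Finset.univ.erase i : Finset ι) = Finset.univ.filter fun j => j ≠ i :=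
      fun i => by
      ext; simp
    simp_rw [e, Finset.sum_filter]
    rw [Finset.sum_comm]
    refine Finset.sum_congr rfl fun i _ => Finset.sum_congr rfl fun j _ => ?_
    by_cases h : i = j
    · simp [h]
    · simp [h, Ne.symm h, hS j i]
  calc (0 : ℝ) ≤ ∑ i, (S i i - ∑ j ∈ Finset.univ.erase i, S i j) * x i ^ 2 :=
        Finset.sum_nonneg fun i _ => mul_nonneg (sub_nonneg.2 (hdom i)) (sq_nonneg _)
    _ = ∑ i, (S i i * x i ^ 2 + (-(1 / 2) * (∑ j ∈ Finset.univ.erase i, S i j * x i ^ 2) -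
        (1 / 2) * ∑ j ∈ Finset.univ.erase i, S i j * x j ^ 2)) := by
      rw [Finset.sum_add_distrib, Finset.sum_sub_distrib, ← Finset.mul_sum, ← Finset.mul_sum,
        hswap]
      simp_rw [sub_mul, Finset.sum_mul, Finset.sum_sub_distrib]
      ring
    _ ≤ _ := by
      refine Finset.sum_le_sum fun i _ => ?_
      rw [hrow]
      linarith [hlow i]

end Multivariate

lemma stdGaussian_forall_lt {ι : Type*} [Fintype ι] (y : ι → ℝ) :
    stdGaussian (EuclideanSpace ℝ ι) {g | ∀ i, g i < y i} =
      ∏ i, gaussianReal 0 1 (Set.Iio (y i)) := by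
  rw [← map_pi_eq_stdGaussian, Measure.map_apply (by fun_prop), ← Measure.pi_pi]
  · congr 1
    ext g
    simp [Set.mem_pi]
  · have : {g : EuclideanSpace ℝ ι | ∀ i, g i < y i} = ⋂ i, {g | g i < y i} := by ext; simp
    rw [this]
    exact MeasurableSet.iInter fun i => measurableSet_lt (by fun_prop) measurable_const

lemma integral_exp_gaussianReal (v : ℝ≥0) :
    ∫ y, Real.exp y ∂(gaussianReal 0 v) = Real.exp (v / 2) := by
  have := congrFun (mgf_id_gaussianReal (μ := 0) (v := v)) 1
  simpa [mgf] using this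

/-- The orthant probabilities of weakly correlated Gaussian vectors decay exponentially in the
dimension. -/
lemma exists_forall_orthant_le_exp (r : ℝ) : ∃ β : ℝ, 0 < β ∧
    ∀ {Ω : Type*} [MeasurableSpace Ω] (P : Measure Ω) (n : ℕ) (X : Fin n → Ω → ℝ),
      HasGaussianLaw (fun ω i => X i ω) P → (∀ i, ∫ ω, X i ω ∂P = 0) →
      (∀ i, ∫ ω, X i ω * X i ω ∂P = 1) → (∀ i j, 0 ≤ ∫ ω, X i ω * X j ω ∂P) →
      (∀ i, ∑ j ∈ Finset.univ.erase i, ∫ ω, X i ω * X j ω ∂P ≤ 1 / 4) →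
      P {ω | ∀ i, X i ω < r} ≤ ENNReal.ofReal (Real.exp (-(β * n))) := by
  set s : ℝ := √(3 / 4) with hs
  have hs0 : 0 < s := by positivity
  have hs2 : s * s = 3 / 4 := Real.mul_self_sqrt (by norm_num)
  -- This `b` satisfies `b - r / s ≥ 1`, so every coordinate contributes a factor `exp (-β)`. Half
  -- of the rate is given up afterwards to pay for the exponential moment of the correlated part.
  obtain ⟨β, hβ0, hβ4, hβ⟩ := exists_gaussianReal_Iio_le_exp (b := |r| / s + 1) (by positivity)
  refine ⟨β / 2, by positivity, fun {Ω} _ P n X hX h0 h1 hpos hrow => ?_⟩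
  have hXm : ∀ i, AEMeasurable (X i) P := fun i => (hX.eval i).aemeasurable
  -- Removing 3/4 from the diagonal leaves 1/4, which still dominates the off-diagonal row sums. So
  -- `S` is a covariance matrix, and `X` has the law of a vector with covariance `S` plus
  -- independent white noise of variance `s * s = 3 / 4`.
  set S : Matrix (Fin n) (Fin n) ℝ := Matrix.of fun i j =>
    (∫ ω, X i ω * X j ω ∂P) - if i = j then 3 / 4 else 0 with hSdef
  have hSapp : ∀ i j, S i j = (∫ ω, X i ω * X j ω ∂P) - if i = j then 3 / 4 else 0 :=
    fun i j => rfl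
  have hSd : ∀ i, S i i = 1 / 4 := fun i => by rw [hSapp, h1]; norm_num
  have hSo : ∀ i j, i ≠ j → S i j = ∫ ω, X i ω * X j ω ∂P := fun i j h => by simp [hSapp, h]
  have hSrow : ∀ i, ∑ j ∈ Finset.univ.erase i, S i j ≤ 1 / 4 := fun i => by
    refine le_trans (Finset.sum_le_sum fun j hj => ?_) (hrow i)
    rw [hSo i j (Finset.ne_of_mem_erase hj).symm]
  have hS : S.PosSemidef := by
    refine posSemidef_of_sum_offDiag_le (fun i j => ?_) (fun i j h => ?_) fun i => ?_
    · simp_rw [hSapp, mul_comm (X i _), eq_comm (a := i)]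
    · rw [hSo i j h]; exact hpos i j
    · rw [hSd]; exact hSrow i
  set μ := multivariateGaussian (0 : EuclideanSpace ℝ (Fin n)) S with hμ
  set γ := stdGaussian (EuclideanSpace ℝ (Fin n)) with hγ
  have hγ1 : γ = multivariateGaussian 0 1 := multivariateGaussian_zero_one.symm
  set Y : Fin n → EuclideanSpace ℝ (Fin n) × EuclideanSpace ℝ (Fin n) → ℝ :=
    fun i p => p.1 i + s * p.2 i with hY
  have hYg : HasGaussianLaw (fun p i => Y i p) (μ.prod γ) :=
    (IsGaussian.hasGaussianLaw_id (μ := μ.prod γ)).map_fun (ContinuousLinearMap.pi fun i =>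
      (EuclideanSpace.proj i : EuclideanSpace ℝ (Fin n) →L[ℝ] ℝ) ∘L ContinuousLinearMap.fst ℝ _ _ +
      s • (EuclideanSpace.proj i : EuclideanSpace ℝ (Fin n) →L[ℝ] ℝ) ∘L
        ContinuousLinearMap.snd ℝ _ _) |>.congr
      (Eventually.of_forall fun p => by ext i; simp [hY])
  have hint : ∀ i, Integrable (fun x : EuclideanSpace ℝ (Fin n) => x i) μ := fun i =>
    (memLp_eval_multivariateGaussian i).integrable one_le_two
  have hintγ : ∀ i, Integrable (fun x : EuclideanSpace ℝ (Fin n) => x i) γ := fun i => by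
    rw [hγ1]; exact (memLp_eval_multivariateGaussian i).integrable one_le_two
  have hY0 : ∀ i, ∫ p, Y i p ∂(μ.prod γ) = 0 := fun i => by
    simp only [hY]
    rw [integral_add ((hint i).comp_fst γ) (((hintγ i).const_mul s).comp_snd μ),
      integral_fun_fst (μ := μ) (ν := γ) (fun x => x i),
      integral_fun_snd (μ := μ) (ν := γ) (fun x => s * x i), integral_const_mul, hγ1,
      integral_eval_multivariateGaussian, integral_eval_multivariateGaussian]
    simp
  have hcov : ∀ i j, ∫ ω, X i ω * X j ω ∂P = ∫ p, Y i p * Y j p ∂(μ.prod γ) := fun i j => by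
    have hL : ∀ i, MemLp (fun x : EuclideanSpace ℝ (Fin n) => s * x i) 2 γ := fun i => by
      rw [hγ1]; exact (memLp_eval_multivariateGaussian i).const_mul s
    have e : ∀ x : EuclideanSpace ℝ (Fin n), s * x i * (s * x j) = 3 / 4 * (x i * x j) :=
      fun x => by rw [← hs2]; ring
    simp only [hY]
    rw [integral_add_mul_add_prod (memLp_eval_multivariateGaussian i)
      (memLp_eval_multivariateGaussian j) (hL i) (hL j) (integral_eval_multivariateGaussian i)
      (integral_eval_multivariateGaussian j), integral_eval_mul_eval_multivariateGaussian hS]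
    simp_rw [e]
    rw [integral_const_mul, hγ1,
      integral_eval_mul_eval_multivariateGaussian Matrix.PosSemidef.one, hSapp, Matrix.one_apply]
    split_ifs <;> ring
  have hmeasY : ∀ i, AEMeasurable (Y i) (μ.prod γ) := fun i => (hYg.eval i).aemeasurable
  rw [measure_forall_lt_eq_map hXm, map_eq_of_integral_mul_eq hX hYg h0 hY0 hcov,
    ← measure_forall_lt_eq_map hmeasY]
  have hset : MeasurableSet {p | ∀ i, Y i p < r} := by
    have : {p | ∀ i, Y i p < r} = ⋂ i, {p | Y i p < r} := by ext; simp
    rw [this]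
    exact MeasurableSet.iInter fun i => measurableSet_lt (by fun_prop) measurable_const
  rw [Measure.prod_apply hset]
  set c : ℝ := β / s with hc
  -- Given the correlated part `x`, the coordinates are independent and the probability is a product
  -- of one-dimensional ones.
  have hpt : ∀ x : EuclideanSpace ℝ (Fin n), γ (Prod.mk x ⁻¹' {p | ∀ i, Y i p < r}) ≤
      ENNReal.ofReal (Real.exp (-(β * n)) * Real.exp (∑ i, -c * x i)) := by
    intro x
    have e : Prod.mk x ⁻¹' {p | ∀ i, Y i p < r} =
        {g : EuclideanSpace ℝ (Fin n) | ∀ i, g i < (r - x i) / s} := by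
      ext g
      simp only [hY, Set.mem_preimage, Set.mem_ofPred_eq]
      refine forall_congr' fun i => ?_
      rw [lt_div_iff₀ hs0]
      constructor <;> intro h <;> linarith
    rw [e, hγ, stdGaussian_forall_lt]
    have hi : ∀ i, gaussianReal 0 1 (Set.Iio ((r - x i) / s)) ≤
        ENNReal.ofReal (Real.exp (-β + -c * x i)) := fun i => by
      rw [← ofReal_measureReal]
      refine ENNReal.ofReal_le_ofReal ((hβ _).trans (Real.exp_le_exp.2 ?_))
      have h1 : r / s ≤ |r| / s := by gcongr; exact le_abs_self r
      have h2 : -c * x i = -β * (x i / s) := by rw [hc]; ring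
      rw [h2, sub_div]
      nlinarith
    refine (Finset.prod_le_prod' fun i _ => hi i).trans (le_of_eq ?_)
    rw [← ENNReal.ofReal_prod_of_nonneg fun i _ => (Real.exp_pos _).le, ← Real.exp_sum,
      Finset.sum_add_distrib, Real.exp_add]
    simp [mul_comm]
  refine (lintegral_mono hpt).trans ?_
  have hμg : HasGaussianLaw (fun (x : EuclideanSpace ℝ (Fin n)) i => x i) μ :=
    (IsGaussian.hasGaussianLaw_id (μ := μ)).map_fun (ContinuousLinearMap.pi fun i =>
      (EuclideanSpace.proj i : EuclideanSpace ℝ (Fin n) →L[ℝ] ℝ))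
  have hsum := map_sum_mul_eq_gaussianReal (X := fun i (x : EuclideanSpace ℝ (Fin n)) => x i) hμg
    integral_eval_multivariateGaussian (fun _ => -c)
  -- Rows of `S` sum to at most 1/2, so the coordinate sum has variance at most `n / 2`. With `c ^ 2
  -- = 4 β ^ 2 / 3` and `β ≤ 1 / 4` the moment is at most `exp (β n / 12)`, well within the
  -- allowance.
  have hexp : ∫ x, Real.exp (∑ i, -c * x i) ∂μ ≤ Real.exp (β / 2 * n) := by
    have hv : ∑ i : Fin n, ∑ j : Fin n, -c * -c * ∫ x, x i * x j ∂μ ≤ β / 12 * n * 2 := by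
      simp_rw [hμ, integral_eval_mul_eval_multivariateGaussian hS, ← Finset.mul_sum]
      have : ∑ i, ∑ j, S i j ≤ ∑ i : Fin n, (1 / 2 : ℝ) := Finset.sum_le_sum fun i _ => by
        rw [← Finset.add_sum_erase _ _ (Finset.mem_univ i), hSd]
        linarith [hSrow i]
      have hc2 : -c * -c = β * β * (4 / 3) := by
        rw [hc]; field_simp; rw [sq, hs2]; ring
      rw [hc2]
      simp only [Finset.sum_const, Finset.card_univ, Fintype.card_fin, nsmul_eq_mul] at this
      have hβb : β * β * (4 / 3) ≤ β * (1 / 3) := by nlinarith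
      calc β * β * (4 / 3) * ∑ i, ∑ j, S i j ≤ β * β * (4 / 3) * (n * (1 / 2)) := by gcongr
        _ ≤ β * (1 / 3) * (n * (1 / 2)) := by gcongr
        _ = _ := by ring
    have hm : ∫ x, Real.exp (∑ i, -c * x i) ∂μ = ∫ y, Real.exp y ∂(gaussianReal 0
        (∑ i : Fin n, ∑ j : Fin n, -c * -c * ∫ x, x i * x j ∂μ).toNNReal) := by
      rw [← hsum, integral_map (by fun_prop) (by fun_prop)]
    rw [hm, integral_exp_gaussianReal]
    refine Real.exp_le_exp.2 ?_
    rw [Real.coe_toNNReal']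
    have : 0 ≤ β * n := by positivity
    rcases max_cases (∑ i : Fin n, ∑ j : Fin n, -c * -c * ∫ x, x i * x j ∂μ) 0 with h | h <;>
      rw [h.1] <;> linarith
  have hexpi : Integrable (fun x : EuclideanSpace ℝ (Fin n) => Real.exp (∑ i, -c * x i)) μ := by
    have h := integrable_exp_mul_gaussianReal (μ := 0)
      (v := (∑ i : Fin n, ∑ j : Fin n, -c * -c * ∫ x, x i * x j ∂μ).toNNReal) 1
    rw [← hsum] at h
    simpa [Function.comp_def] using h.comp_aemeasurable (by fun_prop)
  rw [← ofReal_integral_eq_lintegral_ofReal (hexpi.const_mul _)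
    (Eventually.of_forall fun x => by positivity), integral_const_mul]
  refine ENNReal.ofReal_le_ofReal ?_
  calc Real.exp (-(β * n)) * ∫ x, Real.exp (∑ i, -c * x i) ∂μ
      ≤ Real.exp (-(β * n)) * Real.exp (β / 2 * n) := by gcongr
    _ = _ := by rw [← Real.exp_add]; congr 1; ring

/-! ### The cost of lowering the level: Cameron–Martin shifts -/

/-- The geometric mean of the densities centered at `0` and `2 m` is centered at the midpoint `m`,
and completing the square gives the constant. In this form Cauchy–Schwarz compares the shifted
measure with the centered one. -/
lemma gaussianPDFReal_eq_mul_sqrt (m : ℝ) (v : ℝ≥0) (x : ℝ) :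
    gaussianPDFReal m v x = Real.exp (m ^ 2 / (2 * v)) *
      (√(gaussianPDFReal 0 v x) * √(gaussianPDFReal (2 * m) v x)) := by
  rw [← Real.sqrt_mul (gaussianPDFReal_nonneg _ _ _)]
  have : gaussianPDFReal 0 v x * gaussianPDFReal (2 * m) v x =
      ((√(2 * Real.pi * v))⁻¹ * Real.exp (-(x - m) ^ 2 / (2 * v) - m ^ 2 / (2 * v))) ^ 2 := by
    have e : Real.exp (-(x - 0) ^ 2 / (2 * v)) * Real.exp (-(x - 2 * m) ^ 2 / (2 * v)) =
        Real.exp (-(x - m) ^ 2 / (2 * v) - m ^ 2 / (2 * v)) ^ 2 := by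
      rw [sq (Real.exp _), ← Real.exp_add, ← Real.exp_add]
      congr 1
      ring
    rw [gaussianPDFReal_def, gaussianPDFReal_def, mul_pow, ← e]
    ring
  rw [this, Real.sqrt_sq (by positivity), gaussianPDFReal_def, mul_left_comm, ← Real.exp_add]
  ring_nf

/-- Quantitative quasi-invariance of real Gaussian measures under translation. -/
lemma sq_lintegral_gaussianReal_le {m : ℝ} {v : ℝ≥0} (hv : v ≠ 0) {g : ℝ → ℝ≥0∞}
    (hg : Measurable g) (hg1 : ∀ y, g y ≤ 1) :
    (∫⁻ y, g y ∂(gaussianReal m v)) ^ 2 ≤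
      ENNReal.ofReal (Real.exp (m ^ 2 / v)) * ∫⁻ y, g y ∂(gaussianReal 0 v) := by
  set a : ℝ → ℝ≥0∞ := fun y => ENNReal.ofReal √(gaussianPDFReal 0 v y) with ha
  set b : ℝ → ℝ≥0∞ := fun y => ENNReal.ofReal √(gaussianPDFReal (2 * m) v y) with hb
  have ham : Measurable a :=
    (Real.continuous_sqrt.measurable.comp (measurable_gaussianPDFReal 0 v)).ennreal_ofReal
  have hbm : Measurable b :=
    (Real.continuous_sqrt.measurable.comp (measurable_gaussianPDFReal (2 * m) v)).ennreal_ofReal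
  have hsq : ∀ m' y, ENNReal.ofReal √(gaussianPDFReal m' v y) ^ 2 = gaussianPDF m' v y :=
    fun m' y => by
      rw [← ENNReal.ofReal_pow (Real.sqrt_nonneg _), Real.sq_sqrt (gaussianPDFReal_nonneg _ _ _)]
      rfl
  set E := ENNReal.ofReal (Real.exp (m ^ 2 / (2 * v))) with hE
  have e1 : ∫⁻ y, g y ∂(gaussianReal m v) = E * ∫⁻ y, ((fun y => a y * g y) * b) y := by
    rw [gaussianReal_of_var_ne_zero m hv,
      lintegral_withDensity_eq_lintegral_mul _ (measurable_gaussianPDF m v) hg,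
      ← lintegral_const_mul _ (f := (fun y => a y * g y) * b) ((ham.mul hg).mul hbm)]
    refine lintegral_congr fun y => ?_
    simp only [Pi.mul_apply, gaussianPDF, gaussianPDFReal_eq_mul_sqrt m v y, ha, hb, hE]
    rw [ENNReal.ofReal_mul (Real.exp_pos _).le, ENNReal.ofReal_mul (Real.sqrt_nonneg _)]
    ring
  have e2 : ∫⁻ y, ((fun y => a y * g y) * b) y ≤
      (∫⁻ y, (a y * g y) ^ (2 : ℝ)) ^ (1 / 2 : ℝ) * (∫⁻ y, b y ^ (2 : ℝ)) ^ (1 / 2 : ℝ) :=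
    ENNReal.lintegral_mul_le_Lp_mul_Lq _ Real.HolderConjugate.two_two
      (ham.mul hg).aemeasurable hbm.aemeasurable
  have e3 : ∫⁻ y, b y ^ (2 : ℝ) = 1 := by
    simp_rw [ENNReal.rpow_two, hb, hsq]
    exact lintegral_gaussianPDF_eq_one _ hv
  have e4 : ∫⁻ y, (a y * g y) ^ (2 : ℝ) ≤ ∫⁻ y, g y ∂(gaussianReal 0 v) := by
    rw [gaussianReal_of_var_ne_zero 0 hv,
      lintegral_withDensity_eq_lintegral_mul _ (measurable_gaussianPDF 0 v) hg]
    refine lintegral_mono fun y => ?_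
    simp only [ENNReal.rpow_two, mul_pow, ha, hsq, Pi.mul_apply]
    gcongr
    rw [sq]
    exact mul_le_of_le_one_left zero_le (hg1 y)
  rw [e3, ENNReal.one_rpow, mul_one] at e2
  have hE2 : E ^ 2 = ENNReal.ofReal (Real.exp (m ^ 2 / v)) := by
    rw [hE, ← ENNReal.ofReal_pow (Real.exp_pos _).le, ← Real.exp_nat_mul]
    congr 2
    push_cast
    ring
  calc (∫⁻ y, g y ∂(gaussianReal m v)) ^ 2
      = E ^ 2 * (∫⁻ y, ((fun y => a y * g y) * b) y) ^ 2 := by rw [e1, mul_pow]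
    _ ≤ E ^ 2 * ((∫⁻ y, (a y * g y) ^ (2 : ℝ)) ^ (1 / 2 : ℝ)) ^ 2 := by gcongr
    _ = E ^ 2 * ∫⁻ y, (a y * g y) ^ (2 : ℝ) := by
      rw [← ENNReal.rpow_natCast (_ ^ (1 / 2 : ℝ)) 2, ← ENNReal.rpow_mul]; norm_num
    _ ≤ _ := by rw [hE2]; gcongr

/-- Lowering the level of an orthant by `K` costs at most the exponential of the variance of a
linear combination whose covariances with the coordinates are at least `K`. -/
lemma sq_orthant_add_le {ι : Type*} [Fintype ι] {μ : Measure (ι → ℝ)} [IsGaussian μ]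
    (h0 : ∀ i, ∫ x, x i ∂μ = 0) (c : ι → ℝ) (F : Set ι) (r K v : ℝ) (hv : 0 < v)
    (hvar : ∑ i, c i * ∑ j, c j * ∫ x, x i * x j ∂μ = v)
    (hK : ∀ i ∈ F, K ≤ ∑ j, c j * ∫ x, x i * x j ∂μ) :
    μ {x | ∀ i ∈ F, x i < r + K} ^ 2 ≤
      ENNReal.ofReal (Real.exp v) * μ {x | ∀ i ∈ F, x i < r} := by
  set h : ι → ℝ := fun i => ∑ j, c j * ∫ x, x i * x j ∂μ with hh
  set ℓ : (ι → ℝ) → ℝ := fun x => ∑ j, c j * x j with hℓ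
  set w : ℝ≥0 := ⟨v, hv.le⟩ with hw
  have hw0 : w ≠ 0 := fun e => hv.ne' (congrArg NNReal.toReal e)
  have hid := hasGaussianLaw_coord (μ := μ)
  have hLp : ∀ i, MemLp (fun x : ι → ℝ => x i) 2 μ := fun i => (hid.eval i).memLp_two
  have hℓLp : MemLp ℓ 2 μ := memLp_finsetSum _ fun j _ => (hLp j).const_mul (c j)
  have hℓ0 : ∫ x, ℓ x ∂μ = 0 := by
    rw [integral_finsetSum _ fun j _ => ((hLp j).integrable one_le_two).const_mul _]
    simp [integral_const_mul, h0]
  have hiℓ : ∀ i, ∫ x, x i * ℓ x ∂μ = h i := fun i => by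
    have i1 : ∀ j, Integrable (fun x : ι → ℝ => x i * x j) μ :=
      fun j => (hLp i).integrable_mul (hLp j)
    simp only [hℓ, Finset.mul_sum, mul_left_comm _ (c _)]
    rw [integral_finsetSum _ fun j _ => (i1 j).const_mul _]
    simp [integral_const_mul, hh]
  have hℓℓ : ∫ x, ℓ x * ℓ x ∂μ = v := by
    have e : ∀ x, ℓ x * ℓ x = ∑ i, c i * (x i * ℓ x) := fun x => by
      simp only [hℓ, Finset.sum_mul, mul_assoc]
    have i1 : ∀ j, Integrable (fun x : ι → ℝ => x j * ℓ x) μ :=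
      fun j => (hLp j).integrable_mul hℓLp
    simp_rw [e]
    rw [integral_finsetSum _ fun j _ => (i1 j).const_mul _]
    simp_rw [integral_const_mul, hiℓ]
    exact hvar
  -- Gaussian regression: `W i` is the part of coordinate `i` uncorrelated with `ℓ`, which has
  -- covariance `h i` with it and variance `v`.
  set W : ι → (ι → ℝ) → ℝ := fun i x => x i - h i / v * ℓ x with hW
  have hWLp : ∀ i, MemLp (W i) 2 μ := fun i => (hLp i).sub (hℓLp.const_mul _)
  have hW0 : ∀ i, ∫ x, W i x ∂μ = 0 := fun i => by
    simp only [hW]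
    rw [integral_sub ((hLp i).integrable one_le_two)
      ((hℓLp.integrable one_le_two).const_mul _), integral_const_mul, h0, hℓ0]
    simp
  have hWW : ∀ i j, ∫ x, W i x * W j x ∂μ = (∫ x, x i * x j ∂μ) - h i * h j / v := fun i j => by
    have i1 : Integrable (fun x : ι → ℝ => x i * x j) μ := (hLp i).integrable_mul (hLp j)
    have i2 : ∀ i, Integrable (fun x : ι → ℝ => x i * ℓ x) μ :=
      fun i => (hLp i).integrable_mul hℓLp
    have i3 : Integrable (fun x : ι → ℝ => ℓ x * ℓ x) μ := hℓLp.integrable_mul hℓLp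
    have e : ∀ x, W i x * W j x = x i * x j - h j / v * (x i * ℓ x) - h i / v * (x j * ℓ x)
        + (h i / v * (h j / v)) * (ℓ x * ℓ x) := fun x => by simp only [hW]; ring
    have i4 : Integrable (fun x : ι → ℝ => x i * x j - h j / v * (x i * ℓ x)) μ :=
      i1.sub ((i2 i).const_mul _)
    have i5 : Integrable (fun x : ι → ℝ => x i * x j - h j / v * (x i * ℓ x)
      - h i / v * (x j * ℓ x)) μ := i4.sub ((i2 j).const_mul _)
    simp_rw [e]
    rw [integral_add i5 (i3.const_mul _), integral_sub i4 ((i2 j).const_mul _),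
      integral_sub i1 ((i2 i).const_mul _), integral_const_mul, integral_const_mul,
      integral_const_mul, hiℓ, hiℓ, hℓℓ]
    field_simp
    ring
  set ν := gaussianReal 0 w with hν
  have hyLp : MemLp (fun y : ℝ => y) 2 ν := memLp_id_gaussianReal' 2 (by simp)
  have hyy : ∫ y, y * y ∂ν = v := by
    have := variance_fun_id_gaussianReal (μ := 0) (v := w)
    rw [variance_of_integral_eq_zero (by fun_prop) (by simp)] at this
    simp_rw [sq] at this
    exact this
  -- Replacing `ℓ` by an independent variable of the same law keeps the law of the vector and makes
  -- the shift direction a separate coordinate.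
  set Y : ι → (ι → ℝ) × ℝ → ℝ := fun i p => W i p.1 + h i / v * p.2 with hY
  have hYg : HasGaussianLaw (fun p i => Y i p) (μ.prod ν) :=
    (IsGaussian.hasGaussianLaw_id (μ := μ.prod ν)).map_fun (ContinuousLinearMap.pi fun i =>
      (ContinuousLinearMap.proj (R := ℝ) (φ := fun _ : ι => ℝ) i - (h i / v) •
        ∑ j, c j • ContinuousLinearMap.proj (R := ℝ) (φ := fun _ : ι => ℝ) j) ∘L
          ContinuousLinearMap.fst ℝ _ _ +
      (h i / v) • ContinuousLinearMap.snd ℝ (ι → ℝ) ℝ) |>.congr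
      (Eventually.of_forall fun p => by ext i; simp [hY, hW, hℓ])
  have hY0 : ∀ i, ∫ p, Y i p ∂(μ.prod ν) = 0 := fun i => by
    simp only [hY]
    rw [integral_add (((hWLp i).integrable one_le_two).comp_fst ν)
        (((hyLp.integrable one_le_two).const_mul _).comp_snd μ),
      integral_fun_fst (μ := μ) (ν := ν) (fun x => W i x),
      integral_fun_snd (μ := μ) (ν := ν) (fun y => h i / v * y), integral_const_mul, hW0]
    simp [hν]
  have hcov : ∀ i j, ∫ x, x i * x j ∂μ = ∫ p, Y i p * Y j p ∂(μ.prod ν) := fun i j => by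
    have e : ∀ y : ℝ, h i / v * y * (h j / v * y) = (h i / v * (h j / v)) * (y * y) :=
      fun y => by ring
    simp only [hY]
    rw [integral_add_mul_add_prod (hWLp i) (hWLp j) (hyLp.const_mul _) (hyLp.const_mul _)
      (hW0 i) (hW0 j), hWW]
    simp_rw [e]
    rw [integral_const_mul, hyy]
    field_simp
    ring
  have hlaw : μ = (μ.prod ν).map (fun p i => Y i p) := by
    have := map_eq_of_integral_mul_eq (X := fun i (x : ι → ℝ) => x i) hid hYg h0 hY0 hcov
    simpa using this
  have hYm : Measurable (fun p i => Y i p) := by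
    simp only [hY, hW, hℓ]; fun_prop
  have hset : ∀ t : ι → ℝ, MeasurableSet {x : ι → ℝ | ∀ i ∈ F, x i < t i} := fun t => by
    have : {x : ι → ℝ | ∀ i ∈ F, x i < t i} = ⋂ i ∈ F, {x | x i < t i} := by ext; simp
    rw [this]
    exact MeasurableSet.biInter (Set.to_countable F) fun i _ =>
      measurableSet_lt (measurable_pi_apply i) measurable_const
  set g : ℝ → ℝ≥0∞ := fun y => μ {x | ∀ i ∈ F, Y i (x, y) < r} with hg
  have hgm : Measurable g := measurable_measure_prodMk_right (hYm (hset fun _ => r))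
  have hr : μ {x | ∀ i ∈ F, x i < r} = ∫⁻ y, g y ∂ν := by
    conv_lhs => rw [hlaw]
    rw [Measure.map_apply hYm (hset fun _ => r),
      Measure.prod_apply_symm (hYm (hset fun _ => r))]
    rfl
  -- Translating `y` by `-v` lowers coordinate `i` by exactly `h i`. The cost `exp (m ^ 2 / v)` with
  -- `m = -v` is `exp v`.
  have hrK : μ {x | ∀ i ∈ F, x i < r + h i} = ∫⁻ y, g y ∂(gaussianReal (-v) w) := by
    conv_lhs => rw [hlaw]
    rw [Measure.map_apply hYm (hset fun i => r + h i),
      Measure.prod_apply_symm (hYm (hset fun i => r + h i)), ← zero_sub v,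
      ← gaussianReal_map_sub_const, lintegral_map hgm (by fun_prop)]
    refine lintegral_congr fun y => congrArg μ ?_
    ext x
    simp only [Set.mem_preimage, Set.mem_ofPred_eq, hY]
    refine forall₂_congr fun i _ => ?_
    have : h i / v * (y - v) = h i / v * y - h i := by field_simp
    rw [this]
    constructor <;> intro h <;> linarith
  have hmono : μ {x | ∀ i ∈ F, x i < r + K} ≤ μ {x | ∀ i ∈ F, x i < r + h i} :=
    measure_mono fun x hx i hi => (hx i hi).trans_le (by linarith [hK i hi])
  calc μ {x | ∀ i ∈ F, x i < r + K} ^ 2 ≤ (∫⁻ y, g y ∂(gaussianReal (-v) w)) ^ 2 := by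
        rw [← hrK]; gcongr
    _ ≤ _ := sq_lintegral_gaussianReal_le hw0 hgm fun y => prob_le_one
    _ = _ := by
      rw [hr]
      have : (-v) ^ 2 / (w : ℝ) = v := by
        change (-v) ^ 2 / v = v
        field_simp
      rw [this]

/-! ### Persistence probabilities over a general time set -/

/-- A time set whose initial segments are compact, with a countable subset that is dense in each
initial segment, and where any two times are comparable. -/
structure IsTimeSet {T : Type*} [TopologicalSpace T] [AddCommSemigroup T] (time : T → ℝ)
    (D : Set T) : Prop where
  countable : D.Countable
  isCompact : ∀ x, IsCompact {t | time t ≤ x}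
  subset_closure : ∀ x, {t | time t ≤ x} ⊆ closure (D ∩ {t | time t ≤ x})
  comparable : ∀ s t : T, s = t ∨ (∃ h, t = s + h) ∨ ∃ h, s = t + h

lemma persistenceProb_le_one {T Ω : Type*} [MeasurableSpace Ω] {P : Measure Ω}
    [IsProbabilityMeasure P] {Z : T → Ω → ℝ} {time : T → ℝ} (r x : ℝ) :
    persistenceProb time P Z r x ≤ 1 := prob_le_one

lemma antitone_persistenceProb {T Ω : Type*} [MeasurableSpace Ω] {P : Measure Ω}
    {Z : T → Ω → ℝ} {time : T → ℝ} (r : ℝ) : Antitone (persistenceProb time P Z r) := by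
  refine fun x y hxy => measure_mono fun ω hω => ?_
  rw [Set.mem_ofPred_eq] at hω ⊢
  exact lt_of_le_of_lt (biSup_mono fun t (ht : time t ≤ x) => ht.trans hxy) hω

section

variable {T Ω Ω' : Type*} [TopologicalSpace T] [AddCommSemigroup T] [MeasurableSpace Ω]
  [MeasurableSpace Ω'] {P : Measure Ω} {P' : Measure Ω'} {Z : T → Ω → ℝ} {Z' : T → Ω' → ℝ}
  {A : T → ℝ} {time : T → ℝ} {D : Set T}

namespace IsStationaryGaussian

lemma integral_mul_self (hZ : IsStationaryGaussian P Z A) (t : T) :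
    ∫ ω, Z t ω * Z t ω ∂P = 1 := by
  simpa [sq] using hZ.unit_variance t

lemma integral_mul_congr (hD : IsTimeSet time D) (hZ : IsStationaryGaussian P Z A)
    (hZ' : IsStationaryGaussian P' Z' A) (s t : T) :
    ∫ ω, Z s ω * Z t ω ∂P = ∫ ω, Z' s ω * Z' t ω ∂P' := by
  rcases hD.comparable s t with rfl | ⟨h, rfl⟩ | ⟨h, rfl⟩
  · rw [hZ.integral_mul_self, hZ'.integral_mul_self]
  · rw [hZ.correlation, hZ'.correlation]
  · simp_rw [mul_comm (Z (t + h) _), mul_comm (Z' (t + h) _)]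
    rw [hZ.correlation, hZ'.correlation]

lemma shift (hZ : IsStationaryGaussian P Z A) (τ : T) [ContinuousAdd T] :
    IsStationaryGaussian P (fun t => Z (t + τ)) A where
  isGaussianProcess := hZ.isGaussianProcess.comp_right (· + τ)
  centered t := hZ.centered _
  unit_variance t := hZ.unit_variance _
  correlation s h := by
    rw [add_right_comm]
    exact hZ.correlation _ _
  continuous_paths := hZ.continuous_paths.mono fun ω hω =>
    hω.comp (continuous_id.add continuous_const)

lemma integral_mul_nonneg (hD : IsTimeSet time D) (hZ : IsStationaryGaussian P Z A)
    (hA : ∀ t, 0 ≤ A t) (s t : T) : 0 ≤ ∫ ω, Z s ω * Z t ω ∂P := by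
  rcases hD.comparable s t with rfl | ⟨h, rfl⟩ | ⟨h, rfl⟩
  · rw [hZ.integral_mul_self]; exact zero_le_one
  · rw [hZ.correlation]; exact hA h
  · simp_rw [mul_comm (Z (t + h) _)]
    rw [hZ.correlation]; exact hA h

lemma measure_forall_mem_lt_congr (hD : IsTimeSet time D) (hZ : IsStationaryGaussian P Z A)
    (hZ' : IsStationaryGaussian P' Z' A) {S : Set T} (hS : S.Countable) (r : ℝ) :
    P {ω | ∀ t ∈ S, Z t ω < r} = P' {ω | ∀ t ∈ S, Z' t ω < r} := by
  have := hS.to_subtype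
  have h := measure_forall_lt_congr (X := fun t : S => Z t) (Y := fun t : S => Z' t)
    (hZ.isGaussianProcess.comp_right (Subtype.val : S → T))
    (hZ'.isGaussianProcess.comp_right (Subtype.val : S → T)) (fun t => hZ.centered t)
    (fun t => hZ'.centered t) (fun s t => integral_mul_congr hD hZ hZ' s t) r
  simpa using h

end IsStationaryGaussian

/-- A continuous path attains its maximum on a nonempty compact initial segment, so a strict bound
leaves a margin `1 / (k + 1)`. Conversely, the margin absorbs the loss of strictness in passing from
`D` to its closure. -/
lemma iSup_lt_iff_of_continuous (hD : IsTimeSet time D) {f : T → ℝ} (hf : Continuous f)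
    (r x : ℝ) : (⨆ t ∈ {t : T | time t ≤ x}, (f t : EReal)) < (r : EReal) ↔
      ∃ k : ℕ, ∀ t ∈ D ∩ {t | time t ≤ x}, f t < r - 1 / ((k : ℝ) + 1) := by
  constructor
  · intro h
    rcases Set.eq_empty_or_nonempty {t : T | time t ≤ x} with he | hne
    · exact ⟨0, fun t ht => by rw [he] at ht; exact absurd ht.2 (Set.notMem_empty t)⟩
    · obtain ⟨t₀, ht₀, hmax⟩ := (hD.isCompact x).exists_isMaxOn hne hf.continuousOn
      have h1 : f t₀ < r := by
        have : (f t₀ : EReal) < r := lt_of_le_of_lt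
          (le_iSup₂ (f := fun (t : T) (_ : t ∈ {t : T | time t ≤ x}) => (f t : EReal)) t₀ ht₀) h
        exact_mod_cast this
      obtain ⟨k, hk⟩ := exists_nat_one_div_lt (sub_pos.2 h1)
      exact ⟨k, fun t ht => by
        have : f t ≤ f t₀ := hmax ht.2
        linarith⟩
  · rintro ⟨k, hk⟩
    have hle : ∀ t ∈ {t : T | time t ≤ x}, f t ≤ r - 1 / ((k : ℝ) + 1) := fun t ht =>
      closure_minimal (s := D ∩ {t | time t ≤ x}) (fun s hs => (hk s hs).le)
        (isClosed_le hf continuous_const) (hD.subset_closure x ht)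
    have hlt : r - 1 / ((k : ℝ) + 1) < r := by
      have : 0 < 1 / ((k : ℝ) + 1) := by positivity
      linarith
    exact (iSup₂_le fun t ht => EReal.coe_le_coe_iff.2 (hle t ht)).trans_lt
      (EReal.coe_lt_coe_iff.2 hlt)

lemma monotone_sub_one_div (r : ℝ) : Monotone fun k : ℕ => r - 1 / ((k : ℝ) + 1) :=
  fun k l hkl => sub_le_sub_left (by gcongr) r

/-- The persistence probability as a limit of probabilities of events which involve countably
many times only. -/
lemma tendsto_persistenceProb (hD : IsTimeSet time D) (hZ : IsStationaryGaussian P Z A)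
    (r x : ℝ) :
    Tendsto (fun k : ℕ => P {ω | ∀ t ∈ D ∩ {t | time t ≤ x}, Z t ω < r - 1 / ((k : ℝ) + 1)})
      atTop (𝓝 (persistenceProb time P Z r x)) := by
  have e : persistenceProb time P Z r x =
      P (⋃ k : ℕ, {ω | ∀ t ∈ D ∩ {t | time t ≤ x}, Z t ω < r - 1 / ((k : ℝ) + 1)}) := by
    refine measure_congr (eventuallyEq_set.2 ?_)
    filter_upwards [hZ.continuous_paths] with ω hω
    rw [Set.mem_iUnion]
    exact iSup_lt_iff_of_continuous hD hω r x
  rw [e]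
  exact tendsto_measure_iUnion_atTop fun k l hkl ω hω t ht =>
    (hω t ht).trans_le (monotone_sub_one_div r hkl)

/-- This is why the exponent depends on `A` and `r` only. Comparability of times is what lets `A`
determine every covariance. -/
lemma persistenceProb_congr (hD : IsTimeSet time D) (hZ : IsStationaryGaussian P Z A)
    (hZ' : IsStationaryGaussian P' Z' A) (r x : ℝ) :
    persistenceProb time P Z r x = persistenceProb time P' Z' r x := by
  refine tendsto_nhds_unique (tendsto_persistenceProb hD hZ r x) ?_
  have h : ∀ k : ℕ, P {ω | ∀ t ∈ D ∩ {t | time t ≤ x}, Z t ω < r - 1 / ((k : ℝ) + 1)} =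
      P' {ω | ∀ t ∈ D ∩ {t | time t ≤ x}, Z' t ω < r - 1 / ((k : ℝ) + 1)} := fun k =>
    IsStationaryGaussian.measure_forall_mem_lt_congr hD hZ hZ'
      (hD.countable.mono Set.inter_subset_left) _
  simp_rw [h]
  exact tendsto_persistenceProb hD hZ' r x

/-- Association bounds the joint event from below, and stationarity removes the shift by `τ`. The
hypothesis says that the times up to `x + y` are covered by those up to `x` and the shifted ones up
to `y`. -/
lemma persistenceProb_mul_le [ContinuousAdd T] (hD : IsTimeSet time D)
    (hZ : IsStationaryGaussian P Z A) (hA : ∀ t, 0 ≤ A t) (r : ℝ) {x y : ℝ} {τ : T}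
    (hτ : ∀ t ∈ D, time t ≤ x + y → time t ≤ x ∨ ∃ s ∈ D, time s ≤ y ∧ t = s + τ) :
    persistenceProb time P Z r x * persistenceProb time P Z r y ≤
      persistenceProb time P Z r (x + y) := by
  have := hZ.isGaussianProcess.isProbabilityMeasure
  refine le_of_tendsto_of_tendsto' (ENNReal.Tendsto.mul (tendsto_persistenceProb hD hZ r x)
    (Or.inr (measure_ne_top _ _)) (tendsto_persistenceProb hD hZ r y)
    (Or.inr (measure_ne_top _ _))) (tendsto_persistenceProb hD hZ r (x + y)) fun k => ?_
  set l : ℝ := r - 1 / ((k : ℝ) + 1)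
  have hc : ∀ z, (D ∩ {t | time t ≤ z}).Countable := fun z =>
    hD.countable.mono Set.inter_subset_left
  have hsh : P {ω | ∀ t ∈ D ∩ {t | time t ≤ y}, Z t ω < l} =
      P {ω | ∀ t ∈ (· + τ) '' (D ∩ {t | time t ≤ y}), Z t ω < l} := by
    rw [IsStationaryGaussian.measure_forall_mem_lt_congr hD hZ (hZ.shift τ) (hc y)]
    simp only [Set.forall_mem_image]
  rw [hsh]
  refine (measure_forall_lt_mul_le hZ.isGaussianProcess hZ.centered hZ.integral_mul_self
    (hZ.integral_mul_nonneg hD hA) (hc x) ((hc y).image _) l).trans (measure_mono ?_)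
  rintro ω hω t ⟨htD, ht⟩
  rcases hτ t htD ht with h | ⟨s, hs, hsy, rfl⟩
  · exact hω t (Or.inl ⟨htD, h⟩)
  · exact hω _ (Or.inr ⟨s, ⟨hs, hsy⟩, rfl⟩)

/-- Continuous paths are bounded on compact initial segments. -/
lemma tendsto_persistenceProb_add_natCast (hD : IsTimeSet time D)
    (hZ : IsStationaryGaussian P Z A) (r x : ℝ) :
    Tendsto (fun K : ℕ => persistenceProb time P Z (r + K) x) atTop (𝓝 1) := by
  have := hZ.isGaussianProcess.isProbabilityMeasure
  have e : P (⋃ K : ℕ, {ω | (⨆ t ∈ {t : T | time t ≤ x}, (Z t ω : EReal)) <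
      ((r + K : ℝ) : EReal)}) = 1 := by
    rw [← measure_univ (μ := P)]
    refine measure_congr (eventuallyEq_set.2 ?_)
    filter_upwards [hZ.continuous_paths] with ω hω
    refine ⟨fun _ => trivial, fun _ => ?_⟩
    obtain ⟨b, hb⟩ := (hD.isCompact x).bddAbove_image hω.continuousOn
    obtain ⟨K, hK⟩ := exists_nat_gt (b - r)
    refine Set.mem_iUnion.2 ⟨K, ?_⟩
    rw [Set.mem_ofPred_eq]
    exact lt_of_le_of_lt (b := (b : EReal)) (iSup₂_le fun t ht => EReal.coe_le_coe_iff.2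
      (hb (Set.mem_image_of_mem _ ht))) (EReal.coe_lt_coe_iff.2 (by linarith))
  rw [← e]
  refine tendsto_measure_iUnion_atTop fun K L hKL ω hω => ?_
  rw [Set.mem_ofPred_eq] at hω ⊢
  exact lt_of_lt_of_le hω (EReal.coe_le_coe_iff.2 (by gcongr))

/-- The times carrying the functional need not lie in `S`, so they are adjoined to the tested ones
in a vector indexed by `I ⊕ Fin N`, with zero coefficients on `I`. Repeated times are harmless, as
the Gaussian vector may be degenerate. -/
lemma ofReal_exp_neg_mul_sq_le (hZ : IsStationaryGaussian P Z A) {N : ℕ} (s : Fin N → T)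
    (c : Fin N → ℝ) {S : Set T} (hS : S.Countable) (r K v : ℝ) (hv : 0 < v)
    (hvar : ∑ i, c i * ∑ j, c j * ∫ ω, Z (s i) ω * Z (s j) ω ∂P = v)
    (hK : ∀ t ∈ S, K ≤ ∑ j, c j * ∫ ω, Z t ω * Z (s j) ω ∂P) :
    ENNReal.ofReal (Real.exp (-v)) * P {ω | ∀ t ∈ S, Z t ω < r + K} ^ 2 ≤
      P {ω | ∀ t ∈ S, Z t ω < r} := by
  classical
  have := hZ.isGaussianProcess.isProbabilityMeasure
  refine le_measure_forall_lt_of_finset hZ.isGaussianProcess.aemeasurable hS fun I hI => ?_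
  set idx : I ⊕ Fin N → T := Sum.elim Subtype.val s with hidx
  have hlaw := hasGaussianLaw_comp_index hZ.isGaussianProcess idx
  set μ := P.map (fun ω i => Z (idx i) ω) with hμ
  have hμG : IsGaussian μ := hlaw.isGaussian_map
  have hmap : ∀ {g : (I ⊕ Fin N → ℝ) → ℝ}, Measurable g →
      ∫ x, g x ∂μ = ∫ ω, g (fun i => Z (idx i) ω) ∂P :=
    fun hg => integral_map hlaw.aemeasurable hg.aestronglyMeasurable
  have hcov : ∀ i j, ∫ x, x i * x j ∂μ = ∫ ω, Z (idx i) ω * Z (idx j) ω ∂P :=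
    fun i j => hmap (by fun_prop)
  have hmeas : ∀ l : ℝ, μ {x | ∀ i ∈ Set.range (Sum.inl : I → I ⊕ Fin N), x i < l} =
      P {ω | ∀ t ∈ I, Z t ω < l} := fun l => by
    rw [hμ, Measure.map_apply_of_aemeasurable hlaw.aemeasurable (measurableSet_forall_mem_lt _ _)]
    congr 1
    ext ω
    simp only [Set.mem_preimage, Set.mem_ofPred_eq, Set.forall_mem_range, hidx, Sum.elim_inl]
    exact ⟨fun h t ht => h ⟨t, ht⟩, fun h t => h t t.2⟩
  have key := sq_orthant_add_le (μ := μ)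
    (fun i => (hmap (measurable_pi_apply i)).trans (hZ.centered _)) (Sum.elim 0 c)
    (Set.range Sum.inl) r K v hv (by simp_rw [hcov]; simpa [hidx] using hvar) (by
      rintro _ ⟨⟨t, ht⟩, rfl⟩
      simp_rw [hcov]
      simpa [hidx] using hK t (hI ht))
  rw [hmeas, hmeas] at key
  have hmono : P {ω | ∀ t ∈ S, Z t ω < r + K} ≤ P {ω | ∀ t ∈ I, Z t ω < r + K} :=
    measure_mono fun ω hω t ht => hω t (hI ht)
  calc ENNReal.ofReal (Real.exp (-v)) * P {ω | ∀ t ∈ S, Z t ω < r + K} ^ 2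
      ≤ ENNReal.ofReal (Real.exp (-v)) * (ENNReal.ofReal (Real.exp v) *
        P {ω | ∀ t ∈ I, Z t ω < r}) := by
        gcongr
        exact (pow_le_pow_left' hmono 2).trans key
    _ = P {ω | ∀ t ∈ I, Z t ω < r} := by
      rw [← mul_assoc, ← ENNReal.ofReal_mul (Real.exp_pos _).le, ← Real.exp_add]
      simp

/-- Lowering the level by `K` in a persistence probability. -/
lemma ofReal_exp_neg_mul_persistenceProb_sq_le (hD : IsTimeSet time D)
    (hZ : IsStationaryGaussian P Z A) {N : ℕ} (s : Fin N → T)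
    (c : Fin N → ℝ) (r K v x : ℝ) (hv : 0 < v)
    (hvar : ∑ i, c i * ∑ j, c j * ∫ ω, Z (s i) ω * Z (s j) ω ∂P = v)
    (hK : ∀ t, time t ≤ x → K ≤ ∑ j, c j * ∫ ω, Z t ω * Z (s j) ω ∂P) :
    ENNReal.ofReal (Real.exp (-v)) * persistenceProb time P Z (r + K) x ^ 2 ≤
      persistenceProb time P Z r x := by
  have := hZ.isGaussianProcess.isProbabilityMeasure
  refine le_of_tendsto_of_tendsto' (ENNReal.Tendsto.const_mul
    (ENNReal.Tendsto.pow (tendsto_persistenceProb hD hZ (r + K) x)) (Or.inr ENNReal.ofReal_ne_top))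
    (tendsto_persistenceProb hD hZ r x) fun k => ?_
  have := ofReal_exp_neg_mul_sq_le hZ s c (S := D ∩ {t | time t ≤ x})
    (hD.countable.mono Set.inter_subset_left) (r - 1 / ((k : ℝ) + 1)) K v hv hvar
    fun t ht => hK t ht.2
  rwa [sub_add_eq_add_sub] at this

end

/-! ### Subadditivity and growth under doubling -/

/-- Fekete's lemma for a nonincreasing supermultiplicative function with values in `[0, 1]`. -/
lemma exists_tendsto_neg_log_div {p : ℝ → ℝ≥0∞} (hanti : Antitone p) (hle : ∀ x, p x ≤ 1)
    (hmul : ∀ n m : ℕ, p n * p m ≤ p (n + m)) (hpos : p 1 ≠ 0) :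
    ∃ θ : ℝ, Tendsto (fun x : ℝ => -(((1 / x : ℝ) : EReal) * ENNReal.log (p x))) atTop (𝓝 θ) ∧
      0 ≤ θ ∧ (∀ n : ℕ, n ≠ 0 → θ ≤ -Real.log (p n).toReal / n) ∧
      ∀ t₀ β : ℝ, 0 < t₀ → (∀ n : ℕ, p (t₀ * n) ≤ ENNReal.ofReal (Real.exp (-(β * n)))) →
        β / t₀ ≤ θ := by
  -- Positivity at 1 passes to 0 by monotonicity and to all integers by supermultiplicativity.
  have hnat : ∀ n : ℕ, p n ≠ 0 := by
    intro n
    induction n with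
    | zero =>
      exact fun h => hpos (le_antisymm ((hanti (by simp)).trans h.le) bot_le)
    | succ n ih =>
      intro h
      have := hmul n 1
      rw [Nat.cast_one, ← Nat.cast_succ, h] at this
      exact mul_ne_zero ih hpos (le_antisymm this bot_le)
  have hne : ∀ x, p x ≠ 0 := fun x h =>
    hnat ⌈x⌉₊ (le_antisymm ((hanti (Nat.le_ceil x)).trans h.le) bot_le)
  have htop : ∀ x, p x ≠ ∞ := fun x => ne_top_of_le_ne_top ENNReal.one_ne_top (hle x)
  have hreal : ∀ x, 0 < (p x).toReal := fun x => ENNReal.toReal_pos (hne x) (htop x)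
  set L : ℝ → ℝ := fun x => -Real.log (p x).toReal with hL
  have hL0 : ∀ x, 0 ≤ L x := fun x =>
    neg_nonneg.2 (Real.log_nonpos (hreal x).le (ENNReal.toReal_le_of_le_ofReal zero_le_one
      (by simpa using hle x)))
  have hLmono : Monotone L := fun x y hxy => neg_le_neg (Real.log_le_log (hreal y)
    (ENNReal.toReal_mono (htop x) (hanti hxy)))
  have hsub : Subadditive fun n : ℕ => L n := fun n m => by
    have h1 : (p n).toReal * (p m).toReal ≤ (p (n + m)).toReal := by
      rw [← ENNReal.toReal_mul]
      exact ENNReal.toReal_mono (htop _) (hmul n m)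
    have h2 := Real.log_le_log (mul_pos (hreal _) (hreal _)) h1
    rw [Real.log_mul (hreal _).ne' (hreal _).ne'] at h2
    simp only [hL]
    push_cast
    linarith
  have hbdd : BddBelow (Set.range fun n : ℕ => L n / n) :=
    ⟨0, by rintro _ ⟨n, rfl⟩; exact div_nonneg (hL0 _) (Nat.cast_nonneg _)⟩
  have hlim := hsub.tendsto_lim hbdd
  set θ := hsub.lim
  have hfl : Tendsto (fun x : ℝ => ⌊x⌋₊) atTop atTop := tendsto_nat_floor_atTop
  have hfl1 : Tendsto (fun x : ℝ => ⌊x⌋₊ + 1) atTop atTop :=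
    tendsto_atTop_mono (fun x => Nat.le_succ _) hfl
  have hr : Tendsto (fun x : ℝ => (⌊x⌋₊ : ℝ) / x) atTop (𝓝 1) := tendsto_nat_floor_div_atTop
  have hr1 : Tendsto (fun x : ℝ => ((⌊x⌋₊ + 1 : ℕ) : ℝ) / x) atTop (𝓝 1) := by
    have := hr.add tendsto_inv_atTop_zero
    simpa [add_div] using this
  -- Monotonicity of `L` squeezes `L x / x` between expressions at `⌊x⌋₊` and `⌊x⌋₊ + 1`, which
  -- extends the limit from integers to reals.
  have hmain : Tendsto (fun x : ℝ => L x / x) atTop (𝓝 θ) := by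
    have l1 := (hlim.comp hfl).mul hr
    have l2 := (hlim.comp hfl1).mul hr1
    rw [mul_one] at l1 l2
    refine tendsto_of_tendsto_of_tendsto_of_le_of_le' l1 l2 ?_ ?_
    · filter_upwards [eventually_ge_atTop 1] with x hx
      have hn : (0 : ℝ) < ⌊x⌋₊ := by exact_mod_cast Nat.floor_pos.2 hx
      simp only [Function.comp_apply]
      rw [div_mul_div_cancel₀ hn.ne']
      have := hLmono (Nat.floor_le (zero_le_one.trans hx))
      gcongr
    · filter_upwards [eventually_ge_atTop 1] with x hx
      have hn : (0 : ℝ) < ((⌊x⌋₊ + 1 : ℕ) : ℝ) := by positivity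
      simp only [Function.comp_apply]
      rw [div_mul_div_cancel₀ hn.ne']
      have := hLmono (show x ≤ ((⌊x⌋₊ + 1 : ℕ) : ℝ) by
        push_cast; exact (Nat.lt_floor_add_one x).le)
      gcongr
  refine ⟨θ, ?_, ?_, ?_, ?_⟩
  · refine (continuous_coe_real_ereal.tendsto θ |>.comp hmain).congr fun x => ?_
    rw [ENNReal.log_pos_real (hne x) (htop x), ← EReal.coe_mul, ← EReal.coe_neg]
    simp only [Function.comp_apply, hL]
    congr 1
    ring
  · exact ge_of_tendsto' hlim fun n => div_nonneg (hL0 _) (Nat.cast_nonneg _)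
  · exact fun n hn => hsub.lim_le_div hbdd hn
  · intro t₀ β ht₀ hβ
    have hx : Tendsto (fun n : ℕ => t₀ * (n : ℝ)) atTop atTop :=
      tendsto_natCast_atTop_atTop.const_mul_atTop ht₀
    refine ge_of_tendsto (hmain.comp hx) ?_
    filter_upwards [eventually_ge_atTop 1] with n hn
    have hn' : (0 : ℝ) < n := by exact_mod_cast hn
    simp only [Function.comp_apply]
    have h1 : (p (t₀ * n)).toReal ≤ Real.exp (-(β * n)) :=
      ENNReal.toReal_le_of_le_ofReal (Real.exp_pos _).le (hβ n)
    have h2 := Real.log_le_log (hreal _) h1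
    rw [Real.log_exp] at h2
    rw [div_le_div_iff₀ ht₀ (by positivity)]
    simp only [hL]
    nlinarith

/-- A function with at most linear growth that tends to infinity cannot square under doubling of
the argument. -/
lemma exists_two_mul_le_mul_sq {S : ℕ → ℝ} (hS : Tendsto S atTop atTop) (hle : ∀ m, S m ≤ m)
    {η : ℝ} (hη : 0 < η) (M : ℝ) : ∃ m : ℕ, 0 < m ∧ M ≤ S m ∧ S (2 * m) ≤ η * S m ^ 2 := by
  by_contra! h
  obtain ⟨m₀, hm₀⟩ := eventually_atTop.1
    ((hS.eventually_ge_atTop (max M (4 / η))).and (eventually_gt_atTop 0))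
  -- If the bound failed at every doubling, `η * S` would at least square each time. Starting from 4
  -- it would outgrow `4 ^ (k + 1)` at `2 ^ k * m₀`, whereas `S m ≤ m` allows only order `2 ^ k`.
  have hgrow : ∀ k : ℕ, (4 : ℝ) ^ (k + 1) ≤ η * S (2 ^ k * m₀) := by
    intro k
    induction k with
    | zero =>
      have := (le_max_right _ _).trans (hm₀ m₀ le_rfl).1
      rw [div_le_iff₀ hη] at this
      simpa [mul_comm] using this
    | succ k ih =>
      have hge : m₀ ≤ 2 ^ k * m₀ := Nat.le_mul_of_pos_left _ (by positivity)
      have hlt := h (2 ^ k * m₀) (hm₀ _ hge).2 ((le_max_left _ _).trans (hm₀ _ hge).1)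
      have e : 2 * (2 ^ k * m₀) = 2 ^ (k + 1) * m₀ := by ring
      rw [e] at hlt
      have h4 : (4 : ℝ) ≤ 4 ^ (k + 1) := le_self_pow₀ (by norm_num) (by simp)
      calc (4 : ℝ) ^ (k + 1 + 1) = 4 * 4 ^ (k + 1) := by ring
        _ ≤ 4 ^ (k + 1) * 4 ^ (k + 1) := by gcongr
        _ ≤ (η * S (2 ^ k * m₀)) * (η * S (2 ^ k * m₀)) :=
          mul_le_mul ih ih (by positivity) ((by positivity : (0 : ℝ) ≤ 4 ^ (k + 1)).trans ih)
        _ = η * (η * S (2 ^ k * m₀) ^ 2) := by ring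
        _ ≤ _ := by gcongr
  obtain ⟨k, hk⟩ := pow_unbounded_of_one_lt (η * m₀) (one_lt_two (α := ℝ))
  have h1 := hgrow k
  have h2 := hle (2 ^ k * m₀)
  push_cast at h2
  have h3 : (4 : ℝ) ^ (k + 1) = 4 * (2 ^ k * 2 ^ k) := by
    rw [pow_succ, ← mul_pow]; norm_num; ring
  have h4 : η * S (2 ^ k * m₀) ≤ η * (2 ^ k * m₀) := by gcongr
  have h5 : (0 : ℝ) < 2 ^ k := by positivity
  nlinarith

/-! ### Criteria for a positive and for a vanishing exponent -/

section

variable {T : Type} {Ω : Type*} [TopologicalSpace T] [AddCommSemigroup T] [ContinuousAdd T]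
  [MeasurableSpace Ω] {P : Measure Ω} {Z : T → Ω → ℝ}
  {A : T → ℝ} {time : T → ℝ} {D : Set T}

lemma persistenceProb_natCast_mul_le (hD : IsTimeSet time D)
    (hZ : IsStationaryGaussian P Z A) (hA : ∀ t, 0 ≤ A t)
    (hshift : ∀ n m : ℕ, 0 < n → ∃ τ, ∀ t ∈ D, time t ≤ n + m → time t ≤ n ∨
      ∃ s ∈ D, time s ≤ m ∧ t = s + τ) (r : ℝ) (n m : ℕ) :
    persistenceProb time P Z r n * persistenceProb time P Z r m ≤
      persistenceProb time P Z r (n + m) := by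
  have := hZ.isGaussianProcess.isProbabilityMeasure
  -- There is no zero shift in `ℕ+`, so `n = 0` is settled by the trivial bound 1.
  rcases n.eq_zero_or_pos with rfl | hn
  · rw [Nat.cast_zero, zero_add]
    exact mul_le_of_le_one_left zero_le (persistenceProb_le_one r _)
  · obtain ⟨τ, hτ⟩ := hshift n m hn
    exact persistenceProb_mul_le hD hZ hA r hτ

lemma persistenceProb_one_pow_le (hD : IsTimeSet time D)
    (hZ : IsStationaryGaussian P Z A) (hA : ∀ t, 0 ≤ A t)
    (hshift : ∀ n m : ℕ, 0 < n → ∃ τ, ∀ t ∈ D, time t ≤ n + m → time t ≤ n ∨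
      ∃ s ∈ D, time s ≤ m ∧ t = s + τ) (r : ℝ) {n : ℕ} (hn : n ≠ 0) :
    persistenceProb time P Z r 1 ^ n ≤ persistenceProb time P Z r n := by
  induction n, Nat.one_le_iff_ne_zero.2 hn using Nat.le_induction with
  | base => simp
  | succ n h ih =>
    rw [pow_succ, Nat.cast_succ]
    have := persistenceProb_natCast_mul_le hD hZ hA hshift r n 1
    rw [Nat.cast_one] at this
    exact (mul_le_mul_left (ih (by lia)) _).trans this

/-- Weak correlations along a sequence of times with bounded gaps give a positive finite
persistence exponent. -/
lemma exists_hasPersistenceExponent (hD : IsTimeSet time D)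
    (hZ : IsStationaryGaussian P Z A) (hA : ∀ t, 0 ≤ A t)
    (hshift : ∀ n m : ℕ, 0 < n → ∃ τ, ∀ t ∈ D, time t ≤ n + m → time t ≤ n ∨
      ∃ s ∈ D, time s ≤ m ∧ t = s + τ) (r : ℝ) (hpos : persistenceProb time P Z r 1 ≠ 0)
    {t₀ : ℝ} (ht₀ : 0 < t₀) (s : ℕ → T) (hs : ∀ n k, k < n → time (s k) ≤ t₀ * n)
    (hrow : ∀ (n : ℕ) (i : Fin n),
      ∑ j ∈ Finset.univ.erase i, ∫ ω, Z (s i) ω * Z (s j) ω ∂P ≤ 1 / 4) :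
    ∃ θ : EReal, 0 < θ ∧ θ < ⊤ ∧ HasPersistenceExponent.{u} time A r θ := by
  have := hZ.isGaussianProcess.isProbabilityMeasure
  obtain ⟨θ, hθ, -, -, hlow⟩ := exists_tendsto_neg_log_div
    (antitone_persistenceProb (P := P) (Z := Z) (time := time) r) (persistenceProb_le_one r)
    (persistenceProb_natCast_mul_le hD hZ hA hshift r) hpos
  obtain ⟨β, hβ, hβb⟩ := exists_forall_orthant_le_exp r
  -- Only the `n` sampled times are kept. A rate `β` per sample is a rate `β / t₀` per unit of time.
  have hθ0 : β / t₀ ≤ θ := hlow t₀ β ht₀ fun n => by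
    refine le_trans (measure_mono (t := {ω | ∀ i : Fin n, Z (s i) ω < r}) fun ω hω i => ?_)
      (hβb P n (fun i : Fin n => Z (s i)) (hasGaussianLaw_comp_index hZ.isGaussianProcess _)
      (fun i => hZ.centered _) (fun i => hZ.integral_mul_self _)
      (fun i j => hZ.integral_mul_nonneg hD hA _ _) (hrow n))
    have h := lt_of_le_of_lt (le_iSup₂ (f := fun (t : T) (_ : t ∈ {t : T | time t ≤ t₀ * n}) =>
      (Z t ω : EReal)) (s i) (hs n i i.2)) hω
    exact_mod_cast h
  refine ⟨θ, EReal.coe_pos.2 ((div_pos hβ ht₀).trans_le hθ0), EReal.coe_lt_top θ, ?_⟩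
  intro Ω' _ P' Z' hZ'
  simp_rw [persistenceProb_congr hD hZ' hZ]
  exact hθ

/-- If cheap Cameron--Martin shifts can raise the process on long time intervals, then the
persistence exponent vanishes. -/
lemma hasPersistenceExponent_zero (hD : IsTimeSet time D)
    (hZ : IsStationaryGaussian P Z A) (hA : ∀ t, 0 ≤ A t)
    (hshift : ∀ n m : ℕ, 0 < n → ∃ τ, ∀ t ∈ D, time t ≤ n + m → time t ≤ n ∨
      ∃ s ∈ D, time s ≤ m ∧ t = s + τ) (r : ℝ) (hpos : persistenceProb time P Z r 1 ≠ 0)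
    (hcheap : ∀ η : ℝ, 0 < η → ∃ (n N : ℕ) (s : Fin N → T) (c : Fin N → ℝ) (v : ℝ), n ≠ 0 ∧
      0 < v ∧ v ≤ η * n ∧ ∑ i, c i * ∑ j, c j * ∫ ω, Z (s i) ω * Z (s j) ω ∂P = v ∧
      ∀ t, time t ≤ n → 1 ≤ ∑ j, c j * ∫ ω, Z t ω * Z (s j) ω ∂P) :
    HasPersistenceExponent.{u} time A r 0 := by
  have := hZ.isGaussianProcess.isProbabilityMeasure
  obtain ⟨θ, hθ, hθ0, hup, -⟩ := exists_tendsto_neg_log_div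
    (antitone_persistenceProb (P := P) (Z := Z) (time := time) r) (persistenceProb_le_one r)
    (persistenceProb_natCast_mul_le hD hZ hA hshift r) hpos
  have hzero : θ ≤ 0 := by
    refine le_of_forall_pos_le_add fun η hη => ?_
    rw [zero_add]
    -- The budget is `η * n`. Level `r + K` costs at most `η / 4` per unit of time, hence `η * n /
    -- 2` after squaring; the shift costs `K ^ 2 * v`, and asking for `v ≤ η / (2 * K ^ 2) * n`
    -- spends the other half.
    obtain ⟨K, hK1, hK⟩ : ∃ K : ℕ, 1 ≤ K ∧
        ENNReal.ofReal (Real.exp (-(η / 4))) ≤ persistenceProb time P Z (r + K) 1 := by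
      have hlt : ENNReal.ofReal (Real.exp (-(η / 4))) < 1 := by
        rw [← ENNReal.ofReal_one, ENNReal.ofReal_lt_ofReal_iff one_pos]
        exact Real.exp_lt_one_iff.2 (by linarith)
      obtain ⟨K, h1, h2⟩ := ((tendsto_persistenceProb_add_natCast hD hZ r 1).eventually
        (lt_mem_nhds hlt) |>.and (eventually_ge_atTop 1)).exists
      exact ⟨K, h2, h1.le⟩
    have hK0 : (0 : ℝ) < K := by exact_mod_cast hK1
    obtain ⟨n, N, s, c, v, hn, hv, hvn, hvar, hc⟩ := hcheap (η / (2 * K ^ 2)) (by positivity)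
    have hn0 : (0 : ℝ) < n := by exact_mod_cast Nat.pos_of_ne_zero hn
    have hlow := ofReal_exp_neg_mul_persistenceProb_sq_le hD hZ s (fun i => K * c i) r K
      (K ^ 2 * v) n (by positivity) (by
        simp_rw [mul_assoc, ← Finset.mul_sum, mul_left_comm (c _) (K : ℝ), ← Finset.mul_sum]
        rw [hvar]; ring) fun t ht => by
      simp_rw [mul_assoc, ← Finset.mul_sum]
      nlinarith [hc t ht]
    have hpow : ENNReal.ofReal (Real.exp (-(η / 4 * n))) ≤ persistenceProb time P Z (r + K) n := by
      refine le_trans (le_of_eq ?_) ((pow_le_pow_left' hK n).trans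
        (persistenceProb_one_pow_le hD hZ hA hshift (r + K) hn))
      rw [← ENNReal.ofReal_pow (Real.exp_pos _).le, ← Real.exp_nat_mul]
      congr 2; ring
    have hfin : ENNReal.ofReal (Real.exp (-(η * n))) ≤ persistenceProb time P Z r n := by
      refine le_trans ?_ ((mul_le_mul_right (pow_le_pow_left' hpow 2) _).trans hlow)
      rw [← ENNReal.ofReal_pow (Real.exp_pos _).le, ← Real.exp_nat_mul,
        ← ENNReal.ofReal_mul (Real.exp_pos _).le, ← Real.exp_add]
      refine ENNReal.ofReal_le_ofReal (Real.exp_le_exp.2 ?_)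
      have : K ^ 2 * v ≤ η / 2 * n := by
        calc K ^ 2 * v ≤ K ^ 2 * (η / (2 * K ^ 2) * n) := by gcongr
          _ = η / 2 * n := by field_simp
      push_cast
      linarith
    refine (hup n hn).trans ?_
    rw [div_le_iff₀ hn0, neg_le]
    have h := ENNReal.toReal_mono (measure_ne_top _ _) hfin
    rw [ENNReal.toReal_ofReal (Real.exp_pos _).le] at h
    have h' := Real.log_le_log (Real.exp_pos _) h
    rw [Real.log_exp] at h'
    exact h'
  have hθe : θ = 0 := le_antisymm hzero hθ0
  intro Ω' _ P' Z' hZ'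
  simp_rw [persistenceProb_congr hD hZ' hZ]
  rw [hθe, EReal.coe_zero] at hθ
  exact hθ

end

/-! ### Row sums of symmetric Toeplitz matrices -/

/-- The distance between two natural numbers splits a symmetric Toeplitz row into two sums. -/
lemma sum_range_dist (a : ℕ → ℝ) {n i : ℕ} (hi : i < n) :
    ∑ j ∈ Finset.range n, a (Nat.dist i j) =
      ∑ k ∈ Finset.range i, a (k + 1) + ∑ k ∈ Finset.range (n - i), a k := by
  rw [Finset.range_eq_Ico, ← Finset.sum_Ico_consecutive _ (Nat.zero_le i) hi.le,
    ← Finset.range_eq_Ico, ← Finset.sum_range_reflect (fun k => a (k + 1)),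
    Finset.sum_Ico_eq_sum_range]
  refine congrArg₂ _ (Finset.sum_congr rfl fun j hj => ?_) (Finset.sum_congr rfl fun j _ => ?_)
  · rw [Finset.mem_range] at hj
    rw [Nat.dist_eq_sub_of_le_right hj.le]
    congr 1
    lia
  · rw [Nat.dist_eq_sub_of_le (Nat.le_add_right i j), Nat.add_sub_cancel_left]

/-- One side of `i` in a window of length `2 * m` contains `m` terms once the diagonal is counted.
When it is the left side, the diagonal term `a 0` is borrowed from the right sum. -/
lemma sum_range_le_sum_range_dist {a : ℕ → ℝ} (ha : ∀ k, 0 ≤ a k) {m i : ℕ} (hi : i < 2 * m) :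
    ∑ k ∈ Finset.range m, a k ≤ ∑ j ∈ Finset.range (2 * m), a (Nat.dist i j) := by
  rw [sum_range_dist a hi]
  have hmono : ∀ {p q : ℕ}, p ≤ q → ∑ k ∈ Finset.range p, a k ≤ ∑ k ∈ Finset.range q, a k :=
    fun hpq => Finset.sum_le_sum_of_subset_of_nonneg (Finset.range_mono hpq) fun k _ _ => ha k
  have h1 : 0 ≤ ∑ k ∈ Finset.range i, a (k + 1) := Finset.sum_nonneg fun k _ => ha _
  rcases lt_or_ge i m with h | h
  · have := hmono (show m ≤ 2 * m - i by lia)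
    linarith
  · have h2 := hmono (show m ≤ i + 1 by lia)
    have h3 := hmono (show 1 ≤ 2 * m - i by lia)
    rw [Finset.sum_range_succ'] at h2
    rw [Finset.sum_range_one] at h3
    linarith

lemma sum_range_dist_le {a : ℕ → ℝ} (ha : ∀ k, 0 ≤ a k) {n i : ℕ} (hi : i < n) :
    ∑ j ∈ Finset.range n, a (Nat.dist i j) ≤ 2 * ∑ k ∈ Finset.range n, a k := by
  rw [sum_range_dist a hi]
  have hmono : ∀ {p q : ℕ}, p ≤ q → ∑ k ∈ Finset.range p, a k ≤ ∑ k ∈ Finset.range q, a k :=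
    fun hpq => Finset.sum_le_sum_of_subset_of_nonneg (Finset.range_mono hpq) fun k _ _ => ha k
  have h2 := hmono (show i + 1 ≤ n by lia)
  have h3 := hmono (show n - i ≤ n by lia)
  rw [Finset.sum_range_succ'] at h2
  linarith [ha 0]

lemma sum_erase_dist_le {b : ℕ → ℝ} (hb : ∀ k, 0 ≤ b k) {C : ℝ}
    (hC : ∀ n, ∑ k ∈ Finset.range n, b (k + 1) ≤ C) {n : ℕ} (i : Fin n) :
    ∑ j ∈ Finset.univ.erase i, b (Nat.dist i j) ≤ 2 * C := by
  -- With the diagonal entry set to zero, the bound for full rows applies to the punctured row.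
  set a : ℕ → ℝ := fun k => if k = 0 then 0 else b k with ha
  have ha0 : a 0 = 0 := rfl
  have hab : ∀ k, k ≠ 0 → a k = b k := fun k hk => if_neg hk
  have ha' : ∀ k, 0 ≤ a k := fun k => by
    by_cases hk : k = 0
    · simp [hk, ha0]
    · rw [hab k hk]; exact hb k
  have e : ∑ j ∈ Finset.univ.erase i, b (Nat.dist i j) =
      ∑ j ∈ Finset.range n, a (Nat.dist i j) := by
    rw [← Fin.sum_univ_eq_sum_range (fun j => a (Nat.dist i j)),
      ← Finset.add_sum_erase _ _ (Finset.mem_univ i), Nat.dist_self, ha0, zero_add]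
    refine Finset.sum_congr rfl fun j hj => (hab _ fun h => ?_).symm
    exact Finset.ne_of_mem_erase hj (Fin.ext (Nat.eq_of_dist_eq_zero h).symm)
  rw [e]
  refine (sum_range_dist_le ha' i.2).trans ?_
  gcongr
  obtain ⟨k, hk⟩ : ∃ k, n = k + 1 := ⟨n - 1, by have := i.2; lia⟩
  rw [hk, Finset.sum_range_succ', ha0, add_zero]
  exact hC k

section

variable {T Ω : Type*} [TopologicalSpace T] [Add T] [MeasurableSpace Ω] {P : Measure Ω}
  {Z : T → Ω → ℝ} {A : T → ℝ}

namespace IsStationaryGaussian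

lemma correlation_le_one [Nonempty T] (hZ : IsStationaryGaussian P Z A) (t : T) : A t ≤ 1 := by
  obtain ⟨s⟩ := ‹Nonempty T›
  have hL : ∀ t, MemLp (Z t) 2 P := fun t => (hZ.isGaussianProcess.hasGaussianLaw_eval t).memLp_two
  have h1 : ∫ ω, (2 * (Z s ω * Z (s + t) ω)) ∂P ≤ ∫ ω, (Z s ω ^ 2 + Z (s + t) ω ^ 2) ∂P :=
    integral_mono (((hL s).integrable_mul (hL (s + t))).const_mul 2)
      ((hL s).integrable_sq.add (hL (s + t)).integrable_sq)
      fun ω => by have := two_mul_le_add_sq (Z s ω) (Z (s + t) ω); simpa [mul_assoc] using this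
  rw [integral_const_mul, hZ.correlation, integral_add (hL s).integrable_sq
    (hL (s + t)).integrable_sq, hZ.unit_variance, hZ.unit_variance] at h1
  linarith

lemma measure_lt_ne_zero (hZ : IsStationaryGaussian P Z A) (t : T) (r : ℝ) :
    P {ω | Z t ω < r} ≠ 0 := by
  have hlaw := hZ.isGaussianProcess.hasGaussianLaw_eval t
  have hmap : P.map (Z t) = gaussianReal 0 1 := by
    rw [hlaw.map_eq_gaussianReal, hZ.centered,
      variance_of_integral_eq_zero hlaw.aemeasurable (hZ.centered t), hZ.unit_variance]
    simp
  have e : P {ω | Z t ω < r} = gaussianReal 0 1 (Set.Iio r) := by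
    rw [← hmap, Measure.map_apply_of_aemeasurable hlaw.aemeasurable measurableSet_Iio]
    rfl
  rw [e]
  intro h
  have := gaussianReal_absolutelyContinuous' 0 one_ne_zero h
  simp at this

end IsStationaryGaussian

end

/-! ### Discrete time -/

section Discrete

variable {Ω : Type*} [MeasurableSpace Ω] {P : Measure Ω} {Z : ℕ+ → Ω → ℝ} {A : ℕ+ → ℝ}

lemma pnat_exists_eq_add_of_lt {s t : ℕ+} (h : s < t) : ∃ c, t = s + c :=
  ⟨t - s, (PNat.add_sub_of_lt h).symm⟩

lemma isTimeSet_pnat : IsTimeSet (fun n : ℕ+ => (n : ℝ)) Set.univ where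
  countable := Set.countable_univ
  isCompact x := by
    refine Set.Finite.isCompact ((Set.finite_Iic (⟨⌈x⌉₊ + 1, Nat.succ_pos _⟩ : ℕ+)).subset ?_)
    intro t (ht : (t : ℝ) ≤ x)
    have : (t : ℕ) ≤ ⌈x⌉₊ := by exact_mod_cast ht.trans (Nat.le_ceil x)
    exact Subtype.coe_le_coe.1 (this.trans (Nat.le_succ _))
  subset_closure x := by
    rw [Set.univ_inter]
    exact subset_closure
  comparable s t := by
    rcases lt_trichotomy s t with h | h | h
    · obtain ⟨c, hc⟩ := pnat_exists_eq_add_of_lt h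
      exact Or.inr (Or.inl ⟨c, hc⟩)
    · exact Or.inl h
    · obtain ⟨c, hc⟩ := pnat_exists_eq_add_of_lt h
      exact Or.inr (Or.inr ⟨c, hc⟩)

lemma exists_shift_pnat (n m : ℕ) (hn : 0 < n) : ∃ τ : ℕ+, ∀ t ∈ (Set.univ : Set ℕ+),
    (t : ℝ) ≤ n + m → (t : ℝ) ≤ n ∨ ∃ s ∈ (Set.univ : Set ℕ+), (s : ℝ) ≤ m ∧ t = s + τ := by
  lift n to ℕ+ using hn
  refine ⟨n, fun t _ ht => ?_⟩
  rcases le_or_gt t n with h | h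
  · exact Or.inl (by exact_mod_cast h)
  · obtain ⟨c, rfl⟩ := pnat_exists_eq_add_of_lt h
    refine Or.inr ⟨c, trivial, ?_, add_comm _ _⟩
    push_cast at ht
    linarith

/-- The correlation function of a discrete-time process as a function on the natural numbers. -/
noncomputable def natCorrelation (A : ℕ+ → ℝ) (k : ℕ) : ℝ :=
  if h : 0 < k then A ⟨k, h⟩ else 1

lemma natCorrelation_zero : natCorrelation A 0 = 1 := rfl

lemma natCorrelation_coe (t : ℕ+) : natCorrelation A t = A t := dif_pos t.2

lemma natCorrelation_nonneg (hA : ∀ t, 0 ≤ A t) (k : ℕ) : 0 ≤ natCorrelation A k := by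
  unfold natCorrelation
  split_ifs
  · exact hA _
  · exact zero_le_one

/-- The value 1 given to `natCorrelation` at lag 0 is the variance, so the formula includes the
diagonal. -/
lemma integral_mul_eq_natCorrelation (hZ : IsStationaryGaussian P Z A) (s t : ℕ+) :
    ∫ ω, Z s ω * Z t ω ∂P = natCorrelation A (Nat.dist s t) := by
  rcases isTimeSet_pnat.comparable s t with rfl | ⟨h, rfl⟩ | ⟨h, rfl⟩
  · rw [hZ.integral_mul_self, Nat.dist_self, natCorrelation_zero]
  · rw [hZ.correlation, PNat.add_coe, Nat.dist_eq_sub_of_le (Nat.le_add_right _ _),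
      Nat.add_sub_cancel_left, natCorrelation_coe]
  · simp_rw [mul_comm (Z (t + h) _)]
    rw [hZ.correlation, PNat.add_coe, Nat.dist_eq_sub_of_le_right (Nat.le_add_right _ _),
      Nat.add_sub_cancel_left, natCorrelation_coe]

lemma natCorrelation_le_one (hZ : IsStationaryGaussian P Z A) (k : ℕ) :
    natCorrelation A k ≤ 1 := by
  unfold natCorrelation
  split_ifs
  · exact hZ.correlation_le_one _
  · exact le_rfl

lemma persistenceProb_pnat_one_ne_zero (hZ : IsStationaryGaussian P Z A) (r : ℝ) :
    persistenceProb (fun n : ℕ+ => (n : ℝ)) P Z r 1 ≠ 0 := by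
  refine fun h => hZ.measure_lt_ne_zero 1 r (measure_mono_null (fun ω hω => ?_) h)
  rw [Set.mem_ofPred_eq] at hω ⊢
  refine lt_of_le_of_lt (b := (Z 1 ω : EReal)) (iSup₂_le fun t ht => ?_)
    (EReal.coe_lt_coe_iff.2 hω)
  have h1 : (t : ℕ) ≤ 1 := by exact_mod_cast (show (t : ℝ) ≤ 1 from ht)
  have : t = 1 := le_antisymm h1 (one_le)
  rw [this]

lemma summable_natCorrelation_iff (hA : ∀ t, 0 ≤ A t) :
    Summable (natCorrelation A) ↔ ∑' t : ℕ+, ENNReal.ofReal (A t) < ∞ := by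
  rw [← summable_pnat_iff_summable_nat]
  simp_rw [natCorrelation_coe]
  refine ⟨fun h => h.tsum_ofReal_lt_top, fun h => ?_⟩
  simpa [ENNReal.toReal_ofReal (hA _)] using ENNReal.summable_toReal h.ne

/-- The points `M * (k + 1)` are distinct and at least `M`, so their sum is bounded by a tail of the
series. -/
lemma exists_forall_sum_mul_le {a : ℕ → ℝ} (ha : Summable a) (ha0 : ∀ k, 0 ≤ a k) {ε : ℝ}
    (hε : 0 < ε) : ∃ M : ℕ, 0 < M ∧ ∀ n, ∑ k ∈ Finset.range n, a (M * (k + 1)) ≤ ε := by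
  obtain ⟨M, hM, hM0⟩ := (((tendsto_sum_nat_add a).eventually (gt_mem_nhds hε)).and
    (eventually_gt_atTop 0)).exists
  refine ⟨M, hM0, fun n => le_trans ?_ hM.le⟩
  have hinj : Function.Injective fun k : ℕ => M * k := fun k l h =>
    Nat.eq_of_mul_eq_mul_left hM0 h
  have := ((summable_nat_add_iff M).2 ha).sum_le_tsum
    ((Finset.range n).map ⟨fun k => M * k, hinj⟩) fun k _ => ha0 _
  simpa [mul_add] using this

theorem exists_hasPersistenceExponent_pnat (hZ : IsStationaryGaussian P Z A)
    (hA : ∀ t, 0 ≤ A t) (hsum : ∑' t : ℕ+, ENNReal.ofReal (A t) < ∞) (r : ℝ) :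
    ∃ θ : EReal, 0 < θ ∧ θ < ⊤ ∧
      HasPersistenceExponent.{u} (fun n : ℕ+ => (n : ℝ)) A r θ := by
  -- A row extends to both sides of its diagonal, so 1/8 on one side gives the required 1/4.
  obtain ⟨M, hM, hMs⟩ := exists_forall_sum_mul_le ((summable_natCorrelation_iff hA).2 hsum)
    (natCorrelation_nonneg hA) (ε := 1 / 8) (by norm_num)
  lift M to ℕ+ using hM
  refine exists_hasPersistenceExponent isTimeSet_pnat hZ hA exists_shift_pnat r
    (persistenceProb_pnat_one_ne_zero hZ r) (t₀ := M) (by exact_mod_cast M.pos)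
    (fun k => M * k.succPNat) (fun n k hk => ?_) fun n i => ?_
  · have : (M : ℕ) * (k + 1) ≤ M * n := Nat.mul_le_mul_left M hk
    push_cast [Nat.succPNat_coe]
    exact_mod_cast this
  · have h := sum_erase_dist_le (b := fun k => natCorrelation A (M * k))
      (fun k => natCorrelation_nonneg hA _) hMs i
    refine le_trans (le_of_eq (Finset.sum_congr rfl fun j _ => ?_)) (h.trans (by norm_num))
    rw [integral_mul_eq_natCorrelation hZ]
    simp only [PNat.mul_coe, Nat.succPNat_coe, Nat.succ_eq_add_one]
    rw [Nat.dist_mul_left, Nat.dist_add_add_right]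

/-- The functional is the sum of `Z` over `{1, …, 2m}` divided by `S = ∑ k < m, a k`. Its
covariances with the process on this window lie between 1 and `η * S`, so its variance is at most `2
* m * η`. -/
theorem hasPersistenceExponent_zero_pnat (hZ : IsStationaryGaussian P Z A)
    (hA : ∀ t, 0 ≤ A t) (hsum : ∑' t : ℕ+, ENNReal.ofReal (A t) = ∞) (r : ℝ) :
    HasPersistenceExponent.{u} (fun n : ℕ+ => (n : ℝ)) A r 0 := by
  set a := natCorrelation A with ha
  have ha0 : ∀ k, 0 ≤ a k := natCorrelation_nonneg hA
  have hS : Tendsto (fun n => ∑ k ∈ Finset.range n, a k) atTop atTop := by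
    rw [← not_summable_iff_tendsto_nat_atTop_of_nonneg ha0, summable_natCorrelation_iff hA, hsum]
    exact lt_irrefl _
  refine hasPersistenceExponent_zero isTimeSet_pnat hZ hA exists_shift_pnat r
    (persistenceProb_pnat_one_ne_zero hZ r) fun η hη => ?_
  obtain ⟨m, hm, hSm, hgrow⟩ := exists_two_mul_le_mul_sq hS (fun m => by
    simpa using Finset.sum_le_card_nsmul (Finset.range m) a 1
      fun k _ => natCorrelation_le_one hZ k) (η := η / 2) (by positivity) 1
  set S := ∑ k ∈ Finset.range m, a k with hSdef
  have hS0 : 0 < S := by linarith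
  have hm0 : (0 : ℝ) < m := by exact_mod_cast hm
  set s : Fin (2 * m) → ℕ+ := fun i => (i : ℕ).succPNat with hs
  have hcov : ∀ i : Fin (2 * m), ∑ j, 1 / S * ∫ ω, Z (s i) ω * Z (s j) ω ∂P =
      1 / S * ∑ j ∈ Finset.range (2 * m), a (Nat.dist i j) := fun i => by
    rw [← Finset.mul_sum, ← Fin.sum_univ_eq_sum_range (fun j => a (Nat.dist i j))]
    simp_rw [integral_mul_eq_natCorrelation hZ, hs, Nat.succPNat_coe, Nat.succ_eq_add_one,
      Nat.dist_add_add_right]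
    rfl
  have hlow : ∀ i : Fin (2 * m), 1 ≤ ∑ j, 1 / S * ∫ ω, Z (s i) ω * Z (s j) ω ∂P := fun i => by
    rw [hcov, one_div, inv_mul_eq_div, one_le_div hS0]
    exact sum_range_le_sum_range_dist ha0 i.2
  have hup : ∀ i : Fin (2 * m), ∑ j, 1 / S * ∫ ω, Z (s i) ω * Z (s j) ω ∂P ≤ η * S := fun i => by
    rw [hcov, one_div, inv_mul_eq_div, div_le_iff₀ hS0]
    refine (sum_range_dist_le ha0 i.2).trans ?_
    nlinarith
  refine ⟨2 * m, 2 * m, s, fun _ => 1 / S, _, by positivity, ?_, ?_, rfl, fun t ht => ?_⟩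
  · have : Nonempty (Fin (2 * m)) := ⟨⟨0, by lia⟩⟩
    exact Finset.sum_pos (fun i _ => mul_pos (by positivity) (by linarith [hlow i]))
      Finset.univ_nonempty
  · calc ∑ i, 1 / S * ∑ j, 1 / S * ∫ ω, Z (s i) ω * Z (s j) ω ∂P
        ≤ ∑ i : Fin (2 * m), 1 / S * (η * S) := by
          refine Finset.sum_le_sum fun i _ => ?_
          have := hup i
          gcongr
      _ = _ := by
        simp only [Finset.sum_const, Finset.card_univ, Fintype.card_fin, nsmul_eq_mul]
        field_simp
  · have ht' : (t : ℕ) ≤ 2 * m := by exact_mod_cast ht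
    have hti : t = s ⟨t - 1, by have := t.pos; lia⟩ := by
      refine PNat.eq ?_
      have := t.pos
      simp only [hs, Nat.succPNat_coe]
      lia
    rw [hti]
    exact hlow _

end Discrete

/-! ### Continuous time: rational times, positivity, continuity of the correlation -/

section Continuous

variable {Ω : Type*} [MeasurableSpace Ω] {P : Measure Ω} {Z : ℝ≥0 → Ω → ℝ} {A : ℝ≥0 → ℝ}

/-- The nonnegative rational numbers as nonnegative real numbers. -/
def rationalTimes : Set ℝ≥0 := {t | (t : ℝ) ∈ Set.range ((↑) : ℚ → ℝ)}

lemma nnreal_eq_or_exists_eq_add (s t : ℝ≥0) :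
    s = t ∨ (∃ h, t = s + h) ∨ ∃ h, s = t + h := by
  rcases le_total s t with h | h
  · exact Or.inr (Or.inl ⟨t - s, (add_tsub_cancel_of_le h).symm⟩)
  · exact Or.inr (Or.inr ⟨s - t, (add_tsub_cancel_of_le h).symm⟩)

lemma isTimeSet_nnreal : IsTimeSet (fun t : ℝ≥0 => (t : ℝ)) rationalTimes where
  countable := (Set.countable_range _).preimage_of_injOn NNReal.coe_injective.injOn
  isCompact x := by
    refine (isCompact_Icc (a := 0) (b := x.toNNReal)).of_isClosed_subset
      (isClosed_le NNReal.continuous_coe continuous_const) fun t (ht : (t : ℝ) ≤ x) => ?_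
    exact ⟨zero_le, NNReal.le_toNNReal_of_coe_le ht⟩
  subset_closure x := by
    intro t (ht : (t : ℝ) ≤ x)
    rcases eq_or_ne t 0 with rfl | h0
    · exact subset_closure ⟨⟨0, by simp⟩, ht⟩
    · refine Metric.mem_closure_iff.2 fun ε hε => ?_
      have ht0 : (0 : ℝ) < t := by positivity
      obtain ⟨q, hq1, hq2⟩ := exists_rat_btwn (show max ((t : ℝ) - ε) 0 < t from
        max_lt (by linarith) ht0)
      have hq0 : (0 : ℝ) ≤ q := (le_max_right _ _).trans hq1.le
      obtain ⟨b, hb⟩ : ∃ b : ℝ≥0, (b : ℝ) = q := ⟨⟨q, hq0⟩, rfl⟩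
      refine ⟨b, ⟨⟨q, hb.symm⟩, hb.trans_le (hq2.le.trans ht)⟩, ?_⟩
      rw [NNReal.dist_eq, hb, abs_lt]
      have h3 := (le_max_left _ _).trans_lt hq1
      constructor <;> linarith
  comparable := nnreal_eq_or_exists_eq_add

/-- Shifting by a rational time keeps the countable dense set, so the splitting of an interval stays
within it. -/
lemma rationalTimes_shift {x : ℝ≥0} (hx : x ∈ rationalTimes) (y : ℝ) {t : ℝ≥0}
    (ht : t ∈ rationalTimes) (hxy : (t : ℝ) ≤ x + y) :
    (t : ℝ) ≤ x ∨ ∃ s ∈ rationalTimes, (s : ℝ) ≤ y ∧ t = s + x := by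
  rcases le_total t x with h | h
  · exact Or.inl (by exact_mod_cast h)
  · obtain ⟨p, hp⟩ := hx
    obtain ⟨q, hq⟩ := ht
    refine Or.inr ⟨t - x, ⟨q - p, ?_⟩, ?_, (tsub_add_cancel_of_le h).symm⟩
    · rw [NNReal.coe_sub h, Rat.cast_sub, hp, hq]
    · rw [NNReal.coe_sub h]; linarith

lemma exists_shift_nnreal (n m : ℕ) (_ : 0 < n) : ∃ τ : ℝ≥0, ∀ t ∈ rationalTimes,
    (t : ℝ) ≤ n + m → (t : ℝ) ≤ n ∨ ∃ s ∈ rationalTimes, (s : ℝ) ≤ m ∧ t = s + τ :=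
  ⟨n, fun t ht htn => by
    have hn : (n : ℝ≥0) ∈ rationalTimes := ⟨n, by simp⟩
    simpa using rationalTimes_shift hn m ht (by simpa using htn)⟩

lemma correlation_zero (hZ : IsStationaryGaussian P Z A) : A 0 = 1 := by
  rw [← hZ.correlation 0 0, add_zero, hZ.integral_mul_self]

lemma integral_mul_eq_correlation_nndist (hZ : IsStationaryGaussian P Z A) (s t : ℝ≥0) :
    ∫ ω, Z s ω * Z t ω ∂P = A (nndist s t) := by
  have hd : ∀ s h : ℝ≥0, nndist s (s + h) = h := fun s h => by
    rw [NNReal.nndist_eq, tsub_eq_zero_of_le le_self_add, add_tsub_cancel_left,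
      max_eq_right zero_le]
  rcases nnreal_eq_or_exists_eq_add s t with rfl | ⟨h, rfl⟩ | ⟨h, rfl⟩
  · rw [hZ.integral_mul_self, nndist_self, correlation_zero hZ]
  · rw [hZ.correlation, hd]
  · simp_rw [mul_comm (Z (t + h) _)]
    rw [hZ.correlation, nndist_comm, hd]

lemma persistenceProb_one_div_pow_le (hZ : IsStationaryGaussian P Z A) (hA : ∀ t, 0 ≤ A t)
    (r : ℝ) (N k : ℕ) :
    persistenceProb (fun t : ℝ≥0 => (t : ℝ)) P Z r (1 / (N + 1)) ^ (k + 1) ≤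
      persistenceProb (fun t : ℝ≥0 => (t : ℝ)) P Z r ((k + 1) / (N + 1)) := by
  induction k with
  | zero => simp
  | succ k ih =>
    have hx : ((k + 1 : ℝ≥0) / (N + 1)) ∈ rationalTimes := ⟨(k + 1) / (N + 1), by push_cast; rfl⟩
    have := persistenceProb_mul_le isTimeSet_nnreal hZ hA r (x := ((k + 1) / (N + 1) : ℝ))
      (y := 1 / (N + 1)) (τ := (k + 1) / (N + 1)) fun t ht htx => by
        simpa using rationalTimes_shift hx (1 / (N + 1)) ht (by simpa using htx)
    rw [pow_succ]
    refine (mul_le_mul_left ih _).trans (this.trans (le_of_eq ?_))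
    congr 1
    push_cast
    ring

/-- If `Z 0 < r`, continuity keeps the path below `r` on a short interval. So some length `1 / (N +
1)` has positive probability, and supermultiplicativity over `N + 1` such intervals reaches time 1.
-/
lemma persistenceProb_nnreal_one_ne_zero (hZ : IsStationaryGaussian P Z A) (hA : ∀ t, 0 ≤ A t)
    (r : ℝ) : persistenceProb (fun t : ℝ≥0 => (t : ℝ)) P Z r 1 ≠ 0 := by
  obtain ⟨N, hN⟩ : ∃ N : ℕ, persistenceProb (fun t : ℝ≥0 => (t : ℝ)) P Z r (1 / (N + 1)) ≠ 0 := by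
    by_contra! h
    refine hZ.measure_lt_ne_zero 0 r ?_
    have h0 := measure_iUnion_null h
    refine measure_mono_null_ae ?_ h0
    filter_upwards [hZ.continuous_paths] with ω hω hlt
    obtain ⟨b, hb1, hb2⟩ := exists_between (show Z 0 ω < r from hlt)
    obtain ⟨δ, hδ, hball⟩ := Metric.eventually_nhds_iff.1
      (hω.continuousAt.eventually (gt_mem_nhds hb1))
    obtain ⟨N, hN⟩ := exists_nat_one_div_lt hδ
    refine Set.mem_iUnion.2 ⟨N, ?_⟩
    rw [Set.mem_ofPred_eq]
    refine lt_of_le_of_lt (b := (b : EReal)) (iSup₂_le fun t ht => EReal.coe_le_coe_iff.2 ?_)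
      (EReal.coe_lt_coe_iff.2 hb2)
    refine (hball ?_).le
    rw [NNReal.dist_eq, NNReal.coe_zero, sub_zero, abs_of_nonneg (NNReal.coe_nonneg t)]
    exact lt_of_le_of_lt ht hN
  intro h
  have := persistenceProb_one_div_pow_le hZ hA r N N
  rw [div_self (by positivity), h] at this
  exact pow_ne_zero _ hN (le_antisymm this bot_le)

/-- The characteristic function of `Z 0 + Z t` at 1 equals `exp (-(1 + A t))`. It is continuous in
`t` by dominated convergence with a bounded integrand, which avoids any uniform integrability of the
products `Z 0 * Z t`. -/
lemma continuous_correlation (hZ : IsStationaryGaussian P Z A) : Continuous A := by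
  have := hZ.isGaussianProcess.isProbabilityMeasure
  have hm := hZ.isGaussianProcess.aemeasurable
  have hvar : ∀ t, ∫ ω, Complex.exp (((Z 0 ω + Z t ω : ℝ) : ℂ) * Complex.I) ∂P =
      Complex.exp ((-(1 + A t) : ℝ) : ℂ) := fun t => by
    have hL : ∀ t, MemLp (Z t) 2 P :=
      fun t => (hZ.isGaussianProcess.hasGaussianLaw_eval t).memLp_two
    have hlaw := hZ.isGaussianProcess.hasGaussianLaw_fun_add (s := 0) (t := t)
    have h0 : ∫ ω, Z 0 ω + Z t ω ∂P = 0 := by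
      rw [integral_add ((hL 0).integrable one_le_two) ((hL t).integrable one_le_two),
        hZ.centered, hZ.centered, add_zero]
    have hv : ∫ ω, (Z 0 ω + Z t ω) ^ 2 ∂P = 2 + 2 * A t := by
      have i1 : Integrable (fun ω => Z 0 ω ^ 2 + Z t ω ^ 2) P :=
        (hL 0).integrable_sq.add (hL t).integrable_sq
      have i2 : Integrable (fun ω => 2 * (Z 0 ω * Z (0 + t) ω)) P :=
        ((hL 0).integrable_mul (hL (0 + t))).const_mul 2
      have e : ∀ ω, (Z 0 ω + Z t ω) ^ 2 =
          (Z 0 ω ^ 2 + Z t ω ^ 2) + 2 * (Z 0 ω * Z (0 + t) ω) := fun ω => by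
        rw [zero_add]; ring
      simp_rw [e]
      rw [integral_add i1 i2, integral_add (hL 0).integrable_sq (hL t).integrable_sq,
        integral_const_mul, hZ.correlation, hZ.unit_variance, hZ.unit_variance]
      ring
    have hnn : 0 ≤ 2 + 2 * A t := by
      rw [← hv]; exact integral_nonneg fun ω => sq_nonneg _
    have hmap := hlaw.map_eq_gaussianReal
    rw [h0, variance_of_integral_eq_zero hlaw.aemeasurable h0, hv] at hmap
    have hc := charFun_gaussianReal (μ := 0) (v := (2 + 2 * A t).toNNReal) 1
    rw [← hmap, charFun_apply_real, integral_map hlaw.aemeasurable (by fun_prop)] at hc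
    simp only [Complex.ofReal_one, one_mul] at hc
    rw [hc, Real.coe_toNNReal _ hnn]
    congr 1
    push_cast
    ring
  have hcont : Continuous fun t => ∫ ω, Complex.exp (((Z 0 ω + Z t ω : ℝ) : ℂ) * Complex.I) ∂P := by
    refine continuous_of_dominated (bound := fun _ => 1) (fun t => ?_) (fun t => ?_)
      (integrable_const _) ?_
    · exact AEMeasurable.aestronglyMeasurable (Measurable.comp_aemeasurable
        (g := fun x : ℝ => Complex.exp ((x : ℂ) * Complex.I)) (by fun_prop)
        ((hm 0).add (hm t)))
    · exact Eventually.of_forall fun ω => (Complex.norm_exp_ofReal_mul_I _).le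
    · filter_upwards [hZ.continuous_paths] with ω hω
      fun_prop
  have hlog : A = fun t => -1 - Real.log ‖∫ ω, Complex.exp (((Z 0 ω + Z t ω : ℝ) : ℂ) *
      Complex.I) ∂P‖ := by
    funext t
    rw [hvar, Complex.norm_exp_ofReal, Real.log_exp]
    ring
  rw [hlog]
  refine continuous_const.sub (hcont.norm.log fun t => ?_)
  rw [hvar]
  exact norm_ne_zero_iff.2 (Complex.exp_ne_zero _)

end Continuous

/-! ### Sampling an integrable function, and Riemann sums -/

/-- The intervals `((k + 1) M, 2 (k + 1) M]` with weights `1 / (k + 1)` overlap at most twice. -/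
lemma tsum_indicator_Ioc_le_two {M : ℝ} (hM : 0 < M) (v : ℝ) :
    ∑' k : ℕ, (Set.Ioc ((k + 1) * M) ((k + 1) * (2 * M))).indicator
      (fun _ => ENNReal.ofReal (1 / (k + 1))) v ≤ 2 := by
  -- Membership forces `(k + 1) * M < v`, so at most `⌊v / M⌋₊` indices occur, and `v ≤ 2 * (k + 1)
  -- * M` bounds each weight by `2 / (v / M)`.
  rw [tsum_eq_sum (s := Finset.range ⌊v / M⌋₊) fun k hk =>
    Set.indicator_of_notMem (fun h => hk ?_) _]
  · calc ∑ k ∈ Finset.range ⌊v / M⌋₊, (Set.Ioc ((k + 1) * M) ((k + 1) * (2 * M))).indicator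
          (fun _ => ENNReal.ofReal (1 / (k + 1))) v
        ≤ ∑ _k ∈ Finset.range ⌊v / M⌋₊, ENNReal.ofReal (2 / (v / M)) := by
          refine Finset.sum_le_sum fun k _ => ?_
          by_cases h : v ∈ Set.Ioc ((k + 1 : ℝ) * M) ((k + 1) * (2 * M))
          swap
          · rw [Set.indicator_of_notMem h]
            exact zero_le
          rw [Set.indicator_of_mem h]
          have hk : (0 : ℝ) < k + 1 := by positivity
          have hv : 0 < v := lt_trans (by positivity) h.1
          refine ENNReal.ofReal_le_ofReal ?_
          rw [div_le_div_iff₀ hk (by positivity), one_mul, div_le_iff₀ hM]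
          linarith [h.2]
      _ = ENNReal.ofReal (⌊v / M⌋₊ * (2 / (v / M))) := by
          rw [Finset.sum_const, Finset.card_range, nsmul_eq_mul,
            ENNReal.ofReal_mul (Nat.cast_nonneg _), ENNReal.ofReal_natCast]
      _ ≤ ENNReal.ofReal 2 := by
          refine ENNReal.ofReal_le_ofReal ?_
          rcases le_or_gt (v / M) 0 with h | h
          · simp [Nat.floor_of_nonpos h]
          · rw [← mul_div_assoc, div_le_iff₀ h, mul_comm]
            gcongr
            exact Nat.floor_le h.le
      _ = 2 := by simp
  · rw [Finset.mem_range, ← Nat.succ_le_iff, Nat.le_floor_iff' (Nat.succ_ne_zero _),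
      le_div_iff₀ hM]
    push_cast
    exact h.1.le

/-- An integrable function on the half-line has small sums along some arithmetic progression. -/
lemma exists_tsum_mul_le {a : ℝ → ℝ≥0∞} (ha : Measurable a)
    (hint : ∫⁻ t in Set.Ici (0 : ℝ), a t < ∞) {ε : ℝ≥0∞} (hε : ε ≠ 0) :
    ∃ σ : ℝ, 0 < σ ∧ ∑' k : ℕ, a ((k + 1) * σ) ≤ ε := by
  -- Integrate the sums over steps `s` in `(M, 2M]`. The substitution `v = (k + 1) * s` turns the
  -- result into the integral of `a` against an overlap weight that is at most 2. If every sum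
  -- exceeded `ε`, this would be at least `ε * M`, which is impossible for large `M`.
  by_contra! h
  obtain ⟨n, hn⟩ := ENNReal.exists_nat_mul_gt hε
    (ENNReal.mul_ne_top ENNReal.ofNat_ne_top hint.ne : 2 * ∫⁻ t in Set.Ici (0 : ℝ), a t ≠ ∞)
  set M : ℝ := n + 1 with hMdef
  have hM : 0 < M := by positivity
  set w : ℕ → ℝ → ℝ≥0∞ := fun k => (Set.Ioc ((k + 1) * M) ((k + 1) * (2 * M))).indicator
    (fun _ => ENNReal.ofReal (1 / (k + 1))) with hw
  have hwm : ∀ k, Measurable (w k) := fun k => measurable_const.indicator measurableSet_Ioc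
  have hscale : ∀ k : ℕ, ∫⁻ s in Set.Ioc M (2 * M), a ((k + 1) * s) = ∫⁻ v, w k v * a v := by
    intro k
    have hk : (0 : ℝ) < k + 1 := by positivity
    set S := Set.Ioc ((k + 1 : ℝ) * M) ((k + 1) * (2 * M))
    have e1 : Set.Ioc M (2 * M) = (fun s => (k + 1 : ℝ) * s) ⁻¹' S := by
      ext s
      simp only [S, Set.mem_preimage, Set.mem_Ioc, mul_lt_mul_iff_right₀ hk,
        mul_le_mul_iff_right₀ hk]
    rw [e1, ← setLIntegral_map measurableSet_Ioc ha (measurable_const_mul _),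
      Real.map_volume_mul_left hk.ne', Measure.restrict_smul, lintegral_smul_measure,
      ← lintegral_indicator measurableSet_Ioc, smul_eq_mul,
      ← lintegral_const_mul _ (ha.indicator measurableSet_Ioc)]
    refine lintegral_congr fun v => ?_
    simp only [hw, Set.indicator_apply]
    split_ifs
    · rw [abs_of_pos (inv_pos.2 hk), one_div]
    · simp
  have hle : ε * ENNReal.ofReal M ≤ 2 * ∫⁻ t in Set.Ici (0 : ℝ), a t := by
    calc ε * ENNReal.ofReal M = ∫⁻ _ in Set.Ioc M (2 * M), ε := by
          rw [setLIntegral_const, Real.volume_Ioc]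
          congr 2
          ring
      _ ≤ ∫⁻ s in Set.Ioc M (2 * M), ∑' k : ℕ, a ((k + 1) * s) :=
          setLIntegral_mono' measurableSet_Ioc fun s hs => (h s (hM.trans hs.1)).le
      _ = ∑' k : ℕ, ∫⁻ s in Set.Ioc M (2 * M), a ((k + 1) * s) :=
          lintegral_tsum fun k => (ha.comp (measurable_const_mul _)).aemeasurable
      _ = ∫⁻ v, ∑' k, w k v * a v := by
          simp_rw [hscale]
          exact (lintegral_tsum fun k => ((hwm k).mul ha).aemeasurable).symm
      _ ≤ ∫⁻ v, 2 * (Set.Ici (0 : ℝ)).indicator a v := by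
          refine lintegral_mono fun v => ?_
          rw [ENNReal.tsum_mul_right]
          by_cases hv : v ∈ Set.Ici (0 : ℝ)
          · rw [Set.indicator_of_mem hv]
            gcongr
            exact tsum_indicator_Ioc_le_two hM v
          · have : ∀ k, w k v = 0 := fun k => Set.indicator_of_notMem (fun hk => hv
              (le_of_lt (lt_trans (by positivity) hk.1))) _
            simp [this]
      _ = 2 * ∫⁻ t in Set.Ici (0 : ℝ), a t := by
          rw [lintegral_const_mul _ (ha.indicator measurableSet_Ici),
            lintegral_indicator measurableSet_Ici]
  refine absurd (hn.trans_le (le_trans ?_ hle)) (lt_irrefl _)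
  rw [mul_comm]
  gcongr
  rw [← ENNReal.ofReal_natCast]
  exact ENNReal.ofReal_le_ofReal (by rw [hMdef]; linarith)

/-- Left Riemann sums of a function which oscillates by at most `ε` on the cells of the grid. -/
lemma abs_sum_sub_integral_le {B : ℝ → ℝ} (hB : Continuous B) {L ε : ℝ} {N : ℕ} (hN : 0 < N)
    (hosc : ∀ x ∈ Set.Icc 0 L, ∀ y ∈ Set.Icc 0 L, |x - y| ≤ 1 / N → |B x - B y| ≤ ε) {p : ℕ}
    (hp : (p : ℝ) / N ≤ L) :
    |∑ k ∈ Finset.range p, B (k / N) * (1 / N) - ∫ x in (0 : ℝ)..p / N, B x| ≤ p / N * ε := by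
  have hN0 : (0 : ℝ) < N := by exact_mod_cast hN
  have hcell : ∀ k < p, |B (k / N) * (1 / N) - ∫ x in (k / N : ℝ)..((k + 1 : ℕ) / N : ℝ), B x| ≤
      1 / N * ε := by
    intro k hk
    have hlen : ((k + 1 : ℕ) / N : ℝ) - k / N = 1 / N := by push_cast; ring
    have hle : (k / N : ℝ) ≤ ((k + 1 : ℕ) / N : ℝ) := by gcongr; simp
    have hL : ((k + 1 : ℕ) / N : ℝ) ≤ L := le_trans (by gcongr; exact hk) hp
    have hk0 : (0 : ℝ) ≤ k / N := by positivity
    have e : B (k / N) * (1 / N) - ∫ x in (k / N : ℝ)..((k + 1 : ℕ) / N : ℝ), B x =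
        ∫ x in (k / N : ℝ)..((k + 1 : ℕ) / N : ℝ), (B (k / N) - B x) := by
      rw [intervalIntegral.integral_sub (by simp) (hB.intervalIntegrable _ _),
        intervalIntegral.integral_const, hlen, smul_eq_mul, mul_comm]
    rw [e, ← Real.norm_eq_abs]
    refine (intervalIntegral.norm_integral_le_of_norm_le_const (C := ε) fun x hx => ?_).trans
      (le_of_eq ?_)
    · rw [Set.uIoc_of_le hle] at hx
      refine hosc _ ⟨hk0, hle.trans hL⟩ _ ⟨hk0.trans hx.1.le, hx.2.trans hL⟩ ?_
      rw [abs_le]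
      constructor <;> linarith [hx.1, hx.2]
    · rw [hlen, abs_of_pos (by positivity), mul_comm]
  have hsum := intervalIntegral.sum_integral_adjacent_intervals (f := B) (μ := volume)
    (a := fun k : ℕ => (k / N : ℝ)) (n := p) fun k _ => hB.intervalIntegrable _ _
  simp only [Nat.cast_zero, zero_div] at hsum
  rw [← hsum, ← Finset.sum_sub_distrib]
  refine (Finset.abs_sum_le_sum_abs _ _).trans ((Finset.sum_le_sum fun k hk =>
    hcell k (Finset.mem_range.1 hk)).trans (le_of_eq ?_))
  rw [Finset.sum_const, Finset.card_range, nsmul_eq_mul]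
  ring

lemma tendsto_intervalIntegral_of_lintegral_eq_top {B : ℝ → ℝ} (hB : Continuous B)
    (hB0 : ∀ x, 0 ≤ B x) (hint : ∫⁻ t in Set.Ici (0 : ℝ), ENNReal.ofReal (B t) = ∞) :
    Tendsto (fun m : ℕ => ∫ x in (0 : ℝ)..m, B x) atTop atTop := by
  have hmono : Monotone fun m : ℕ => ∫ x in (0 : ℝ)..m, B x := fun m n hmn =>
    intervalIntegral.integral_mono_interval le_rfl (Nat.cast_nonneg _) (by exact_mod_cast hmn)
      (Eventually.of_forall hB0) (hB.intervalIntegrable _ _)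
  rcases tendsto_atTop_of_monotone hmono with h | ⟨l, hl⟩
  · exact h
  · exfalso
    have hi : IntegrableOn B (Set.Ioi 0) :=
      integrableOn_Ioi_of_intervalIntegral_norm_tendsto l 0
        (fun n : ℕ => (hB.intervalIntegrable 0 (n : ℝ)).1) tendsto_natCast_atTop_atTop (by
          simpa only [Real.norm_eq_abs, abs_of_nonneg (hB0 _)] using hl)
    rw [setLIntegral_congr Ioi_ae_eq_Ici.symm] at hint
    exact hi.lintegral_lt_top.ne hint

/-! ### The two cases in continuous time -/

section ContinuousTime

variable {Ω : Type*} [MeasurableSpace Ω] {P : Measure Ω} {Z : ℝ≥0 → Ω → ℝ} {A : ℝ≥0 → ℝ}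

lemma integral_mul_eq_correlation_abs (hZ : IsStationaryGaussian P Z A) (s t : ℝ≥0) :
    ∫ ω, Z s ω * Z t ω ∂P = A |(s : ℝ) - t|.toNNReal := by
  rw [integral_mul_eq_correlation_nndist hZ, ← NNReal.dist_eq, ← coe_nndist, Real.toNNReal_coe]

lemma abs_natCast_sub_natCast (i j : ℕ) : |(i : ℝ) - j| = Nat.dist i j := by
  rcases le_total i j with h | h
  · rw [Nat.dist_eq_sub_of_le h, Nat.cast_sub h, abs_sub_comm,
      abs_of_nonneg (sub_nonneg.2 (Nat.cast_le.2 h))]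
  · rw [Nat.dist_eq_sub_of_le_right h, Nat.cast_sub h,
      abs_of_nonneg (sub_nonneg.2 (Nat.cast_le.2 h))]

theorem exists_hasPersistenceExponent_nnreal (hZ : IsStationaryGaussian P Z A)
    (hA : ∀ t, 0 ≤ A t)
    (hint : ∫⁻ t in Set.Ici (0 : ℝ), ENNReal.ofReal (A t.toNNReal) < ∞) (r : ℝ) :
    ∃ θ : EReal, 0 < θ ∧ θ < ⊤ ∧
      HasPersistenceExponent.{u} (fun t : ℝ≥0 => (t : ℝ)) A r θ := by
  have hAc := continuous_correlation hZ
  obtain ⟨σ, hσ, hsum⟩ := exists_tsum_mul_le (a := fun t => ENNReal.ofReal (A t.toNNReal))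
    (by fun_prop) hint (ε := ENNReal.ofReal (1 / 8)) (by simp)
  refine exists_hasPersistenceExponent isTimeSet_nnreal hZ hA exists_shift_nnreal r
    (persistenceProb_nnreal_one_ne_zero hZ hA r) hσ (fun k => k * σ.toNNReal)
    (fun n k hk => ?_) fun n i => ?_
  · rw [NNReal.coe_mul, NNReal.coe_natCast, Real.coe_toNNReal _ hσ.le, mul_comm]
    gcongr
  · have hC : ∀ n, ∑ k ∈ Finset.range n, A ((k + 1 : ℕ) * σ).toNNReal ≤ 1 / 8 := fun n => by
      rw [← ENNReal.ofReal_le_ofReal_iff (by norm_num),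
        ENNReal.ofReal_sum_of_nonneg fun k _ => hA _]
      push_cast
      exact (ENNReal.sum_le_tsum _).trans hsum
    have h := sum_erase_dist_le (b := fun k => A (k * σ).toNNReal) (fun k => hA _) hC i
    refine le_trans (le_of_eq (Finset.sum_congr rfl fun j _ => ?_)) (h.trans (by norm_num))
    rw [integral_mul_eq_correlation_abs hZ, ← abs_natCast_sub_natCast]
    simp only [NNReal.coe_mul, NNReal.coe_natCast, Real.coe_toNNReal _ hσ.le]
    rw [← sub_mul, abs_mul, abs_of_pos hσ]

/-- The functional is a Riemann sum for a multiple of the integral of `Z` over `[0, 2m]`. The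
discretization errors are bounded by constants and absorbed using `I ≥ 1`. -/
theorem hasPersistenceExponent_zero_nnreal (hZ : IsStationaryGaussian P Z A)
    (hA : ∀ t, 0 ≤ A t)
    (hint : ∫⁻ t in Set.Ici (0 : ℝ), ENNReal.ofReal (A t.toNNReal) = ∞) (r : ℝ) :
    HasPersistenceExponent.{u} (fun t : ℝ≥0 => (t : ℝ)) A r 0 := by
  set B : ℝ → ℝ := fun x => A x.toNNReal with hBdef
  have hB : Continuous B := (continuous_correlation hZ).comp continuous_real_toNNReal
  have hB0 : ∀ x, 0 ≤ B x := fun x => hA _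
  have hB1 : ∀ x, B x ≤ 1 := fun x => hZ.correlation_le_one _
  refine hasPersistenceExponent_zero isTimeSet_nnreal hZ hA exists_shift_nnreal r
    (persistenceProb_nnreal_one_ne_zero hZ hA r) fun η hη => ?_
  obtain ⟨m, hm, hIm, hgrow⟩ := exists_two_mul_le_mul_sq
    (tendsto_intervalIntegral_of_lintegral_eq_top hB hB0 hint) (fun m => by
      have := intervalIntegral.integral_mono_on (Nat.cast_nonneg m)
        (hB.intervalIntegrable (μ := volume) 0 m) (intervalIntegrable_const (c := (1 : ℝ)))
        fun x _ => hB1 x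
      simpa using this) (η := η / 16) (by positivity) 1
  set I := ∫ x in (0 : ℝ)..m, B x with hI
  have hI0 : 0 < I := by linarith
  have hm0 : (0 : ℝ) < m := by exact_mod_cast hm
  have hI2 : I ≤ ∫ x in (0 : ℝ)..(2 * m : ℕ), B x :=
    intervalIntegral.integral_mono_interval le_rfl hm0.le
      (by exact_mod_cast Nat.le_mul_of_pos_left m two_pos) (Eventually.of_forall hB0)
      (hB.intervalIntegrable _ _)
  set I2 := ∫ x in (0 : ℝ)..(2 * m : ℕ), B x with hI2def
  -- Oscillation `1 / (8 * m)` on cells gives a Riemann sum error of at most 1/8 over `[0, m]` and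
  -- 1/4 over `[0, 2m]`.
  obtain ⟨N, hN, hosc⟩ : ∃ N : ℕ, 0 < N ∧ ∀ x ∈ Set.Icc (0 : ℝ) (2 * m),
      ∀ y ∈ Set.Icc (0 : ℝ) (2 * m), |x - y| ≤ 1 / N → |B x - B y| ≤ 1 / (8 * m) := by
    obtain ⟨δ, hδ, h⟩ := Metric.uniformContinuousOn_iff.1
      (isCompact_Icc.uniformContinuousOn_of_continuous
        (hB.continuousOn (s := Set.Icc (0 : ℝ) (2 * m)))) (1 / (8 * m)) (by positivity)
    obtain ⟨N, hN⟩ := exists_nat_one_div_lt hδ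
    refine ⟨N + 1, Nat.succ_pos _, fun x hx y hy hxy => (h x hx y hy ?_).le⟩
    rw [Real.dist_eq]
    push_cast at hxy
    exact hxy.trans_lt hN
  have hN0 : (0 : ℝ) < N := by exact_mod_cast hN
  set a : ℕ → ℝ := fun k => B (k / N) with ha
  have ha0 : ∀ k, 0 ≤ a k := fun k => hB0 _
  have hlow1 : (I - 1 / 8) * N ≤ ∑ k ∈ Finset.range (m * N), a k := by
    have h := abs_sum_sub_integral_le hB hN hosc (p := m * N) (by
      push_cast; rw [mul_div_cancel_right₀ _ hN0.ne']; linarith)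
    push_cast at h
    rw [mul_div_cancel_right₀ _ hN0.ne', ← Finset.sum_mul] at h
    have e : (m : ℝ) * (1 / (8 * m)) = 1 / 8 := by field_simp
    rw [e, ← hI] at h
    have h' := (abs_le.1 h).1
    rw [← le_div_iff₀ hN0, div_eq_mul_one_div (∑ k ∈ Finset.range (m * N), a k)]
    linarith
  have hup1 : ∑ k ∈ Finset.range (2 * (m * N)), a k ≤ (I2 + 1 / 4) * N := by
    have ep : ((2 * (m * N) : ℕ) : ℝ) / N = 2 * m := by
      push_cast; rw [← mul_assoc, mul_div_cancel_right₀ _ hN0.ne']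
    have h := abs_sum_sub_integral_le hB hN hosc (p := 2 * (m * N)) ep.le
    rw [ep, ← Finset.sum_mul] at h
    have e : (2 * m : ℝ) * (1 / (8 * m)) = 1 / 4 := by field_simp; norm_num
    rw [e] at h
    rw [hI2def]
    push_cast
    have h' := (abs_le.1 h).2
    rw [← div_le_iff₀ hN0, div_eq_mul_one_div (∑ k ∈ Finset.range (2 * (m * N)), a k)]
    linarith
  set M := m * N with hM
  set s : Fin (2 * M) → ℝ≥0 := fun j => (j : ℕ) / N with hs
  -- The factor 2 makes up for discretization: the grid sums at any time of the window are at least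
  -- `N * (I - 3 / 8)`, which is at least `N * I / 2`.
  set c : ℝ := 2 / (N * I) with hc
  have hc0 : 0 < c := by positivity
  have hsle : ∀ j : ℕ, j < 2 * M → (j : ℝ) / N ≤ 2 * m := fun j hj => by
    rw [div_le_iff₀ hN0]
    have : (j : ℝ) ≤ (2 * M : ℕ) := by exact_mod_cast hj.le
    rw [hM] at this
    push_cast at this
    linarith
  have hgrid : ∀ i j : ℕ, |(i / N : ℝ) - j / N| = (Nat.dist i j : ℕ) / N := fun i j => by
    rw [← sub_div, abs_div, abs_natCast_sub_natCast, abs_of_pos hN0]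
  have hcov : ∀ i : Fin (2 * M), ∑ j, c * ∫ ω, Z (s i) ω * Z (s j) ω ∂P =
      c * ∑ j ∈ Finset.range (2 * M), a (Nat.dist i j) := fun i => by
    rw [← Finset.mul_sum, ← Fin.sum_univ_eq_sum_range (fun j => a (Nat.dist i j))]
    simp_rw [integral_mul_eq_correlation_abs hZ, hs, NNReal.coe_div, NNReal.coe_natCast, hgrid]
    rfl
  have hup : ∀ i : Fin (2 * M), ∑ j, c * ∫ ω, Z (s i) ω * Z (s j) ω ∂P ≤ c * (4 * N * I2) :=
    fun i => by
      rw [hcov]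
      have := sum_range_dist_le ha0 i.2
      gcongr
      nlinarith
  have hlow : ∀ t : ℝ≥0, (t : ℝ) ≤ (2 * m : ℕ) → 1 ≤ ∑ j, c * ∫ ω, Z t ω * Z (s j) ω ∂P := by
    intro t ht
    push_cast at ht
    have hM0 : 0 < M := Nat.mul_pos hm hN
    obtain ⟨i, hi, hti⟩ : ∃ i < 2 * M, |(t : ℝ) - i / N| ≤ 1 / N := by
      have hfl := Nat.floor_le (mul_nonneg t.coe_nonneg hN0.le)
      have hlt := Nat.lt_floor_add_one ((t : ℝ) * N)
      rcases lt_or_ge ⌊(t : ℝ) * N⌋₊ (2 * M) with h | h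
      · refine ⟨_, h, ?_⟩
        rw [abs_le]
        constructor
        · rw [← sub_nonneg]
          have : (⌊(t : ℝ) * N⌋₊ : ℝ) / N ≤ t := by rwa [div_le_iff₀ hN0]
          have : 0 < 1 / (N : ℝ) := by positivity
          linarith
        · rw [sub_le_iff_le_add, ← add_div, le_div_iff₀ hN0]
          linarith
      -- Only `t = 2 * m` falls beyond the grid. The last grid point is at distance exactly `1 / N`
      -- from it.
      · refine ⟨2 * M - 1, by lia, ?_⟩
        have h1 : ((2 * M : ℕ) : ℝ) ≤ t * N := (Nat.cast_le.2 h).trans hfl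
        have e : ((2 * M - 1 : ℕ) : ℝ) = 2 * m * N - 1 := by
          rw [Nat.cast_sub (by lia), hM]; push_cast; ring
        rw [hM] at h1
        push_cast at h1
        have h2 : (t : ℝ) = 2 * m := le_antisymm ht (le_of_mul_le_mul_right (by linarith) hN0)
        rw [e, h2, sub_div, mul_div_cancel_right₀ _ hN0.ne', sub_sub_cancel,
          abs_of_pos (by positivity)]
    have hdiff : ∀ j ∈ Finset.range (2 * M), a (Nat.dist i j) - 1 / (8 * m) ≤
        B |(t : ℝ) - j / N| := by
      intro j hj
      have hj' := hsle j (Finset.mem_range.1 hj)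
      have hi' := hsle i hi
      have hj0 : (0 : ℝ) ≤ j / N := by positivity
      have hi0 : (0 : ℝ) ≤ i / N := by positivity
      have ht0 := t.coe_nonneg
      have h := hosc |(i / N : ℝ) - j / N| ⟨abs_nonneg _, abs_le.2 (by constructor <;> linarith)⟩
        |(t : ℝ) - j / N| ⟨abs_nonneg _, abs_le.2 (by constructor <;> linarith)⟩
        ((abs_abs_sub_abs_le_abs_sub _ _).trans (by
          rw [sub_sub_sub_cancel_right, abs_sub_comm]; exact hti))
      rw [hgrid] at h
      have := (abs_le.1 h).2
      simp only [ha]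
      linarith
    have hsum := Finset.sum_le_sum hdiff
    rw [Finset.sum_sub_distrib, Finset.sum_const, Finset.card_range, nsmul_eq_mul] at hsum
    have hrow := sum_range_le_sum_range_dist ha0 hi
    have e : ((2 * M : ℕ) : ℝ) * (1 / (8 * m)) = N / 4 := by
      rw [hM]; push_cast; field_simp; norm_num
    rw [e] at hsum
    have hcovt : ∑ j, c * ∫ ω, Z t ω * Z (s j) ω ∂P =
        c * ∑ j ∈ Finset.range (2 * M), B |(t : ℝ) - j / N| := by
      rw [← Finset.mul_sum, ← Fin.sum_univ_eq_sum_range (fun j => B |(t : ℝ) - j / N|)]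
      simp_rw [integral_mul_eq_correlation_abs hZ, hs, NNReal.coe_div, NNReal.coe_natCast]
      rfl
    have hfin : N * I / 2 ≤ ∑ j ∈ Finset.range (2 * M), B |(t : ℝ) - j / N| := by nlinarith
    calc (1 : ℝ) = c * (N * I / 2) := by rw [hc]; field_simp
      _ ≤ _ := by rw [hcovt]; gcongr
  have hsm : ∀ j, ((s j : ℝ≥0) : ℝ) ≤ (2 * m : ℕ) := fun j => by
    have := hsle j j.2
    simp only [hs, NNReal.coe_div, NNReal.coe_natCast]
    push_cast
    exact this
  refine ⟨2 * m, 2 * M, s, fun _ => c, _, by positivity, ?_, ?_, rfl, hlow⟩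
  · have : Nonempty (Fin (2 * M)) := ⟨⟨0, Nat.mul_pos two_pos (Nat.mul_pos hm hN)⟩⟩
    exact Finset.sum_pos (fun i _ => mul_pos hc0 (by linarith [hlow _ (hsm i)]))
      Finset.univ_nonempty
  · calc ∑ i, c * ∑ j, c * ∫ ω, Z (s i) ω * Z (s j) ω ∂P
        ≤ ∑ _i : Fin (2 * M), c * (c * (4 * N * I2)) := by
          refine Finset.sum_le_sum fun i _ => ?_
          have := hup i
          gcongr
      -- The mesh cancels: there are `2 * m * N` terms, each `c ^ 2 * 4 * N * I2`. The choice `I2 ≤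
      -- η / 16 * I ^ 2` then gives exactly `η * (2 * m)`.
      _ = 32 * m * I2 / I ^ 2 := by
          simp only [Finset.sum_const, Finset.card_univ, Fintype.card_fin, nsmul_eq_mul, hM, hc]
          push_cast
          field_simp
          ring
      _ ≤ η * (2 * m : ℕ) := by
          rw [div_le_iff₀ (by positivity)]
          push_cast
          nlinarith

end ContinuousTime

theorem lemma3p1 :
    -- discrete time `{1, 2, …}` ; the integral of `A ≥ 0` against the counting measure is the sum
    (∀ (Ω : Type u) [MeasurableSpace Ω] (P : Measure Ω) (Z : ℕ+ → Ω → ℝ) (A : ℕ+ → ℝ),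
      IsStationaryGaussian P Z A → (∀ t, 0 ≤ A t) →
        ((∑' t : ℕ+, ENNReal.ofReal (A t)) < ∞ →
          ∀ r : ℝ, ∃ θ : EReal, 0 < θ ∧ θ < ⊤ ∧
            HasPersistenceExponent.{u} (fun n : ℕ+ => (n : ℝ)) A r θ) ∧
        ((∑' t : ℕ+, ENNReal.ofReal (A t)) = ∞ →
          ∀ r : ℝ, HasPersistenceExponent.{u} (fun n : ℕ+ => (n : ℝ)) A r 0)) ∧
    -- continuous time `[0, ∞)` ; the integral of `A ≥ 0` against Lebesgue measure
    (∀ (Ω : Type u) [MeasurableSpace Ω] (P : Measure Ω) (Z : ℝ≥0 → Ω → ℝ) (A : ℝ≥0 → ℝ),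
      IsStationaryGaussian P Z A → (∀ t, 0 ≤ A t) →
        ((∫⁻ t in Set.Ici (0 : ℝ), ENNReal.ofReal (A t.toNNReal)) < ∞ →
          ∀ r : ℝ, ∃ θ : EReal, 0 < θ ∧ θ < ⊤ ∧
            HasPersistenceExponent.{u} (fun t : ℝ≥0 => (t : ℝ)) A r θ) ∧
        ((∫⁻ t in Set.Ici (0 : ℝ), ENNReal.ofReal (A t.toNNReal)) = ∞ →
          ∀ r : ℝ, HasPersistenceExponent.{u} (fun t : ℝ≥0 => (t : ℝ)) A r 0)) :=
  ⟨fun _ _ _ _ _ hZ hA => ⟨fun h r => exists_hasPersistenceExponent_pnat hZ hA h r,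
      fun h r => hasPersistenceExponent_zero_pnat hZ hA h r⟩,
    fun _ _ _ _ _ hZ hA => ⟨fun h r => exists_hasPersistenceExponent_nnreal hZ hA h r,
      fun h r => hasPersistenceExponent_zero_nnreal hZ hA h r⟩⟩
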